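/- Let $D\ge 1$ be an odd square-free integer, $\chi$ a primitive Dirichlet character modulo $D$, and $e\ge 1$, $3\le \ell\le k$ integers with $\ell\equiv k\pmod 2$ and $\chi(-1)=(-1)^\ell$; if $\ell=k$, assume that $\chi=\chi_D$ is the quadratic character $\left(\frac{\cdot}{D}\right)$ modulo $D$. Put $q=e^{2\pi i z}$ with $\operatorname{Im} z>0$. For Dirichlet characters $\phi,\psi$ and $m\ge 3$ put $$G_{m,\phi}(z)=\tfrac12L(1-m,\phi)+\sum_{n\ge1}\Big(\sum_{d\mid n}\phi(d)d^{m-1}\Big)q^n,\qquad G_{m,\phi,\psi}(z)=\sum_{n\ge0}\sigma_{m-1,\phi,\psi}(n)q^n,$$ where $\sigma_{m-1,\phi,\psi}(0)=-L(1-m,\phi)L(0,\psi)$ and $\sigma_{m-1,\phi,\psi}(n)=\sum_{d_1d_2=n}\phi(d_1)\psi(d_2)d_1^{m-1}$ for $n\ge1$. With $f^{(r)}=(2\pi i)^{-r}\,d^rf/dz^r$, the Rankin--Cohen bracket of $f,g$ of weights $a,b$ is $$[f,g]_e=\sum_{r=0}^e(-1)^r\binom{e+a-1}{e-r}\binom{e+b-1}{r}f^{(r)}g^{(e-r)}.$$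 For $m\ge 1$ and $f$ of period $1$ let $U_mf(z)=\frac1m\sum_{v\bmod m}f\big(\frac{z+v}{m}\big)$. Let $$\mathcal F_{D,\ell,k,e}(z;\chi)=\sum_{\gamma\in\Gamma_0(D)\backslash \mathrm{SL}_2(\mathbb Z)}[G_{\ell,\chi},G_{k,\overline\chi}]_e\big|_{k+\ell+2e}\gamma$$ be the trace from level $D$ to level $1$ (for $\ell=k$ the bracket is $[G_{k,\chi_D},G_{k,\chi_D}]_e$). Then $[G_{\ell,\chi},G_{k,\overline\chi}]_e$ is invariant under the weight $k+\ell+2e$ action of $\Gamma_0(D)$, so that this trace is well defined, and $$\mathcal F_{D,\ell,k,e}(z;\chi)=\sum_{D=D_1D_2}\overline{\chi}_2(-1)\,D_2^{-e}\,U_{D_2}\big([G_{\ell,\chi_1,\overline\chi_2},G_{k,\overline\chi_1,\chi_2}]_e\big)(z),$$ where the sum is over all ordered factorizations of $D$ into two positive integers and $\chi=\chi_1\chi_2$ is the corresponding factorization into primitive characters modulo $D_1$ and $D_2$. Consequently $\mathcal F_{D,\ell,k,e}(z;\chi)=\sum_{n\ge1}a_{D,\ell,k,e}(n;\chi)q^n$,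 where for $n\geq 1$ $$a_{D,\ell,k,e}(n;\chi)=\sum_{D=D_1D_2}\overline\chi_2(-1)D_2^{-e}\sum_{\substack{a_1,a_2\ge0\\a_1+a_2=nD_2}}\sigma_{\ell-1,\chi_1,\overline\chi_2}(a_1)\,\sigma_{k-1,\overline\chi_1,\chi_2}(a_2)\,c_{e,a_1,a_2},$$ $$c_{e,a_1,a_2}=\sum_{r=0}^e(-1)^ra_1^ra_2^{e-r}\binom{e+\ell-1}{e-r}\binom{e+k-1}{r}\qquad(0^0=1).$$ -/

import Mathlib

open scoped MatrixGroups ModularForm UpperHalfPlane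

noncomputable section

namespace TraceEis

/-! ### Factorizations `D = D₁ D₂` and the corresponding factorization of characters -/

/-- The ordered factorizations `D = D₁ * D₂` into two positive integers (for `D ≠ 0`);
`D₁ = p.1.1` and `D₂ = p.1.2`. -/
abbrev Factorization (D : ℕ) : Type := {p : ℕ × ℕ // p ∈ D.divisorsAntidiagonal}

namespace Factorization

variable {D : ℕ}

abbrev D₁ (p : Factorization D) : ℕ := p.1.1

abbrev D₂ (p : Factorization D) : ℕ := p.1.2

theorem mul_eq (p : Factorization D) : p.D₁ * p.D₂ = D :=
  (Nat.mem_divisorsAntidiagonal.mp p.2).1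

theorem mul_eq' (p : Factorization D) : p.D₂ * p.D₁ = D := by
  rw [mul_comm]; exact p.mul_eq

instance (p : Factorization D) : NeZero p.D₁ :=
  ⟨fun h => (Nat.mem_divisorsAntidiagonal.mp p.2).2 (by rw [← p.mul_eq, h, zero_mul])⟩

instance (p : Factorization D) : NeZero p.D₂ :=
  ⟨fun h => (Nat.mem_divisorsAntidiagonal.mp p.2).2 (by rw [← p.mul_eq, h, mul_zero])⟩

theorem coprime (p : Factorization D) (hD : Squarefree D) : Nat.Coprime p.D₁ p.D₂ :=
  Nat.coprime_of_squarefree_mul (by rw [p.mul_eq]; exact hD)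

end Factorization

/-- For `m * n = D` with `m`, `n` coprime, the component modulo `m` of a character `χ` modulo `D`:
`a ↦ χ b` where `b ≡ a` modulo `m` and `b ≡ 1` modulo `n`, for `a` a unit modulo `m`. -/
def component {m n D : ℕ} (hmn : m * n = D) (hc : Nat.Coprime m n)
    (χ : DirichletCharacter ℂ D) : DirichletCharacter ℂ m :=
  MulChar.ofUnitHom
    ((DirichletCharacter.changeLevel (Dvd.intro_left 1 (by rw [one_mul, hmn])) χ :
        DirichletCharacter ℂ (m * n)).toUnitHom.comp
      ((Units.map ((ZMod.chineseRemainder hc).symm : ZMod m × ZMod n →* ZMod (m * n))).comp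
        ((MulEquiv.prodUnits.symm.toMonoidHom : (ZMod m)ˣ × (ZMod n)ˣ →* (ZMod m × ZMod n)ˣ).comp
          (MonoidHom.inl (ZMod m)ˣ (ZMod n)ˣ))))

/-- The factor `χ₁` modulo `D₁` of `χ = χ₁ χ₂`. -/
def fst {D : ℕ} (hD : Squarefree D) (χ : DirichletCharacter ℂ D) (p : Factorization D) :
    DirichletCharacter ℂ p.D₁ :=
  component p.mul_eq (p.coprime hD) χ

/-- The factor `χ₂` modulo `D₂` of `χ = χ₁ χ₂`. -/
def snd {D : ℕ} (hD : Squarefree D) (χ : DirichletCharacter ℂ D) (p : Factorization D) :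
    DirichletCharacter ℂ p.D₂ :=
  component p.mul_eq' (p.coprime hD).symm χ

/-- The defining property of the component, in terms of any `b ≡ a` modulo `m`, `b ≡ 1` modulo `n`. -/
theorem component_apply {m n D : ℕ} (hmn : m * n = D) (hc : Nat.Coprime m n)
    (χ : DirichletCharacter ℂ D) (u : (ZMod m)ˣ) (b : ZMod D) (h₁ : (b.cast : ZMod m) = u)
    (h₂ : (b.cast : ZMod n) = 1) : component hmn hc χ u = χ b := by
  subst hmn
  have hb : b = (ZMod.chineseRemainder hc).symm ((u : ZMod m), 1) := by
    rw [RingEquiv.eq_symm_apply]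
    ext
    · simp [ZMod.chineseRemainder, h₁]
    · simp [ZMod.chineseRemainder, h₂]
  rw [hb, component, MulChar.ofUnitHom_coe]
  simp only [DirichletCharacter.changeLevel_self, MonoidHom.comp_apply, MulChar.coe_toUnitHom]
  rfl

theorem changeLevel_component_mul {m n D : ℕ} [NeZero D] (hmn : m * n = D) (hc : Nat.Coprime m n)
    (hnm : n * m = D) (χ : DirichletCharacter ℂ D) :
    DirichletCharacter.changeLevel (Dvd.intro _ hmn) (component hmn hc χ) *
      DirichletCharacter.changeLevel (Dvd.intro _ hnm) (component hnm hc.symm χ) = χ := by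
  obtain rfl : D = m * n := hmn.symm
  ext u
  rw [MulChar.mul_apply, DirichletCharacter.changeLevel_eq_cast_of_dvd,
    DirichletCharacter.changeLevel_eq_cast_of_dvd,
    ← ZMod.unitsMap_val (Dvd.intro _ hmn), ← ZMod.unitsMap_val (Dvd.intro _ hnm)]
  have key : ∀ x : ZMod m × ZMod n,
      (((ZMod.chineseRemainder hc).symm x).cast : ZMod m) = x.1 ∧
      (((ZMod.chineseRemainder hc).symm x).cast : ZMod n) = x.2 := by
    intro x
    have h := (ZMod.chineseRemainder hc).apply_symm_apply x
    have h' : ∀ y : ZMod (m * n), ZMod.chineseRemainder hc y = (y.cast, y.cast) := by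
      intro y
      ext <;> simp [ZMod.chineseRemainder]
    rw [h'] at h
    exact ⟨congrArg Prod.fst h, congrArg Prod.snd h⟩
  rw [component_apply hmn hc χ _ ((ZMod.chineseRemainder hc).symm ((u : ZMod (m * n)).cast, 1))
      (by rw [(key _).1, ZMod.unitsMap_val]) (key _).2,
    component_apply hnm hc.symm χ _
      ((ZMod.chineseRemainder hc).symm (1, (u : ZMod (m * n)).cast))
      (by rw [(key _).2, ZMod.unitsMap_val]) (key _).1, ← map_mul, ← map_mul]
  congr 1
  rw [RingEquiv.symm_apply_eq]
  ext <;> simp [ZMod.chineseRemainder]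

/-- `χ = χ₁ χ₂`. -/
theorem fst_mul_snd {D : ℕ} [NeZero D] (hD : Squarefree D) (χ : DirichletCharacter ℂ D)
    (p : Factorization D) :
    DirichletCharacter.changeLevel (Dvd.intro _ p.mul_eq) (fst hD χ p) *
      DirichletCharacter.changeLevel (Dvd.intro _ p.mul_eq') (snd hD χ p) = χ :=
  changeLevel_component_mul p.mul_eq (p.coprime hD) p.mul_eq' χ

/-- The factors of a primitive character are primitive. -/
theorem isPrimitive_fst_snd {D : ℕ} [NeZero D] (hD : Squarefree D) (χ : DirichletCharacter ℂ D)
    (hχ : χ.IsPrimitive) (p : Factorization D) :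
    (fst hD χ p).IsPrimitive ∧ (snd hD χ p).IsPrimitive := by
  have h := fst_mul_snd hD χ p
  have := hχ
  set χ₁ := fst hD χ p
  set χ₂ := snd hD χ p
  have d₁ := χ₁.conductor_dvd_level
  have d₂ := χ₂.conductor_dvd_level
  have hdvd : χ₁.conductor * χ₂.conductor ∣ D := by
    have := mul_dvd_mul d₁ d₂
    rwa [p.mul_eq] at this
  have hf : χ.FactorsThrough (χ₁.conductor * χ₂.conductor) := by
    refine ⟨hdvd, DirichletCharacter.changeLevel (Dvd.intro _ rfl) χ₁.primitiveCharacter *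
      DirichletCharacter.changeLevel (Dvd.intro_left _ rfl) χ₂.primitiveCharacter, ?_⟩
    rw [map_mul, ← DirichletCharacter.changeLevel_trans, ← DirichletCharacter.changeLevel_trans]
    conv_lhs => rw [← h, ← χ₁.changeLevel_primitiveCharacter, ← χ₂.changeLevel_primitiveCharacter]
    rw [← DirichletCharacter.changeLevel_trans, ← DirichletCharacter.changeLevel_trans]
  have hD' := DirichletCharacter.conductor_dvd_of_mem_conductorSet χ hf
  rw [(DirichletCharacter.isPrimitive_def χ).mp hχ] at hD'
  have heq : χ₁.conductor * χ₂.conductor = p.D₁ * p.D₂ := by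
    rw [p.mul_eq]; exact Nat.dvd_antisymm hdvd hD'
  have l₁ := Nat.le_of_dvd (NeZero.pos _) d₁
  have l₂ := Nat.le_of_dvd (NeZero.pos _) d₂
  have p₁ : 0 < p.D₁ := NeZero.pos _
  have p₂ : 0 < p.D₂ := NeZero.pos _
  exact ⟨le_antisymm l₁ (by nlinarith), le_antisymm l₂ (by nlinarith)⟩

/-- The quadratic character `χ_D = (· / D)` modulo `D` (for `D` odd and square-free), given by the
Jacobi symbol. -/
def quadChar (D : ℕ) [NeZero D] : DirichletCharacter ℂ D where
  toFun a := (jacobiSym (a.val : ℤ) D : ℂ)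
  map_one' := by
    rw [ZMod.val_one_eq_one_mod, Int.natCast_mod, ← jacobiSym.mod_left]
    simp
  map_mul' a b := by
    rw [ZMod.val_mul, Int.natCast_mod, ← jacobiSym.mod_left, Nat.cast_mul, jacobiSym.mul_left,
      Int.cast_mul]
  map_nonunit' a ha := by
    rw [Int.cast_eq_zero, jacobiSym.eq_zero_iff_not_coprime, Int.gcd_natCast_natCast]
    intro h
    exact ha (by rw [← ZMod.natCast_zmod_val a]; exact (ZMod.isUnit_iff_coprime _ _).mpr h)

/-! ### Twisted divisor functions -/

/-- `σ_{k-1,χ}(n) = ∑_{d ∣ n} χ(d) d^{k-1}` for `n ≥ 1`, and `σ_{k-1,χ}(0) = L(1-k,χ)/2`. -/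
def sigmaOne {N : ℕ} [NeZero N] (k : ℕ) (χ : DirichletCharacter ℂ N) (n : ℕ) : ℂ :=
  if n = 0 then χ.LFunction (1 - k) / 2
  else ∑ d ∈ n.divisors, χ (d : ZMod N) * (d : ℂ) ^ (k - 1)

/-- `σ_{k-1,φ,ψ}(n) = ∑_{d₁ d₂ = n} φ(d₁) ψ(d₂) d₁^{k-1}` for `n ≥ 1`, and
`σ_{k-1,φ,ψ}(0) = -L(1-k,φ) L(0,ψ)`. -/
def sigmaTwo {M N : ℕ} [NeZero M] [NeZero N] (k : ℕ) (φ : DirichletCharacter ℂ M)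
    (ψ : DirichletCharacter ℂ N) (n : ℕ) : ℂ :=
  if n = 0 then -(φ.LFunction (1 - k) * ψ.LFunction 0)
  else ∑ d ∈ n.divisorsAntidiagonal,
    φ (d.1 : ZMod M) * ψ (d.2 : ZMod N) * (d.1 : ℂ) ^ (k - 1)

/-! ### Eisenstein series -/

/-- `q = e^{2πiz}`. -/
def q (z : ℍ) : ℂ := Complex.exp (2 * Real.pi * Complex.I * (z : ℂ))

/-- `G_{k,χ}(z) = ∑_{n ≥ 0} σ_{k-1,χ}(n) q^n`. -/
def GOne {N : ℕ} [NeZero N] (k : ℕ) (χ : DirichletCharacter ℂ N) (z : ℍ) : ℂ :=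
  ∑' n : ℕ, sigmaOne k χ n * q z ^ n

/-- `G_{k,φ,ψ}(z) = ∑_{n ≥ 0} σ_{k-1,φ,ψ}(n) q^n`. -/
def GTwo {M N : ℕ} [NeZero M] [NeZero N] (k : ℕ) (φ : DirichletCharacter ℂ M)
    (ψ : DirichletCharacter ℂ N) (z : ℍ) : ℂ :=
  ∑' n : ℕ, sigmaTwo k φ ψ n * q z ^ n

/-! ### Rankin–Cohen brackets, the trace and the operator `U_m` -/

/-- The `e`-th Rankin–Cohen bracket of `f` and `g`, regarded as forms of weights `a` and `b`
(`a, b ≥ 1`); the derivative is normalized: `f' = (2πi)⁻¹ df/dz`. -/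
def rankinCohen (a b e : ℕ) (f g : ℍ → ℂ) (z : ℍ) : ℂ :=
  ∑ r ∈ Finset.range (e + 1), (-1 : ℂ) ^ r * ((e + a - 1).choose (e - r) : ℂ) *
    ((e + b - 1).choose r : ℂ) *
    (Derivative.normalizedDerivOfComplex^[r] f z) *
    (Derivative.normalizedDerivOfComplex^[e - r] g z)

/-- The set `Γ₀(D) \ SL₂(ℤ)` of right cosets `Γ₀(D) γ`. -/
abbrev Gamma0Cosets (D : ℕ) : Type :=
  Quotient (QuotientGroup.rightRel (CongruenceSubgroup.Gamma0 D))

instance (D : ℕ) [NeZero D] : Finite (Gamma0Cosets D) :=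
  haveI : Finite (SL(2, ℤ) ⧸ CongruenceSubgroup.Gamma0 D) := inferInstance
  Finite.of_equiv _
    (QuotientGroup.quotientRightRelEquivQuotientLeftRel (CongruenceSubgroup.Gamma0 D)).symm

/-- The trace from level `D` to level `1` in weight `m`: the (finite) sum of `g |_m γ` over
representatives `γ` of `Γ₀(D) \ SL₂(ℤ)`. -/
def trace (D : ℕ) (m : ℤ) (g : ℍ → ℂ) : ℍ → ℂ :=
  ∑ᶠ c : Gamma0Cosets D, g ∣[m] (c.out : SL(2, ℤ))

/-- For `g` of weight `m` on `Γ₀(D)`, the trace does not depend on the representatives. -/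
theorem trace_eq (D : ℕ) (m : ℤ) (g : ℍ → ℂ)
    (hg : ∀ γ ∈ CongruenceSubgroup.Gamma0 D, g ∣[m] γ = g)
    (s : Gamma0Cosets D → SL(2, ℤ)) (hs : ∀ c, (Quotient.mk _ (s c) : Gamma0Cosets D) = c) :
    trace D m g = ∑ᶠ c : Gamma0Cosets D, g ∣[m] s c := by
  refine finsum_congr fun c => ?_
  have h := QuotientGroup.rightRel_apply.mp (Quotient.exact ((hs c).trans c.out_eq.symm))
  conv_lhs => rw [← inv_mul_cancel_right c.out (s c), SlashAction.slash_mul, hg _ h]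

/-- The point `(z + v) / m` of the upper half plane. -/
def shiftDiv (m : ℕ) [NeZero m] (v : ℕ) (z : ℍ) : ℍ :=
  ⟨((z : ℂ) + v) / m, by
    rw [Complex.div_natCast_im, Complex.add_im, Complex.natCast_im, add_zero]
    exact div_pos z.im_pos (Nat.cast_pos.mpr (NeZero.pos m))⟩

/-- `U_m f (z) = (1/m) ∑_{v mod m} f((z + v)/m)`, for a function `f` of period `1`. -/
def U (m : ℕ) [NeZero m] (f : ℍ → ℂ) (z : ℍ) : ℂ :=
  (1 / (m : ℂ)) * ∑ v ∈ Finset.range m, f (shiftDiv m v z)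

/-! ### The construction and its Fourier coefficients -/

/-- The bracket whose trace is taken: `[G_{ℓ,χ}, G_{k,χ̄}]_e` for `ℓ < k`, and
`[G_{k,χ_D}, G_{k,χ_D}]_e` for `ℓ = k`. -/
def bracket {D : ℕ} [NeZero D] (ℓ k e : ℕ) (χ : DirichletCharacter ℂ D) : ℍ → ℂ :=
  if ℓ < k then rankinCohen ℓ k e (GOne ℓ χ) (GOne k (star χ))
  else rankinCohen k k e (GOne k (quadChar D)) (GOne k (quadChar D))

/-- `𝓕_{D,ℓ,k,e}(z;χ)`. -/
def F {D : ℕ} [NeZero D] (ℓ k e : ℕ) (χ : DirichletCharacter ℂ D) : ℍ → ℂ :=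
  trace D ((ℓ + k + 2 * e : ℕ) : ℤ) (bracket ℓ k e χ)

/-- `c_{e,a₁,a₂}` (which also depends on `ℓ` and `k`). -/
def cCoeff (ℓ k e a₁ a₂ : ℕ) : ℂ :=
  ∑ r ∈ Finset.range (e + 1), (-1 : ℂ) ^ r * (a₁ : ℂ) ^ r * (a₂ : ℂ) ^ (e - r) *
    ((e + ℓ - 1).choose (e - r) : ℂ) * ((e + k - 1).choose r : ℂ)

/-- `a_{D,ℓ,k,e}(n;χ)`. -/
def aCoeff {D : ℕ} (hD : Squarefree D) (ℓ k e : ℕ) (χ : DirichletCharacter ℂ D) (n : ℕ) : ℂ :=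
  ∑ p : Factorization D, star (snd hD χ p) (-1) * ((p.D₂ : ℂ) ^ e)⁻¹ *
    ∑ a ∈ Finset.HasAntidiagonal.antidiagonal (n * p.D₂),
      sigmaTwo ℓ (fst hD χ p) (star (snd hD χ p)) a.1 *
      sigmaTwo k (star (fst hD χ p)) (snd hD χ p) a.2 * cCoeff ℓ k e a.1 a.2

end TraceEis

end

/-! The series $G_{k,\chi}$ is, up to the nonzero constant `eisConst`, the lattice sum of
$\bar\chi(d)(cz+d)^{-k}$ over pairs with $D\mid c$. The slash action of $\mathrm{SL}_2(\mathbb Z)$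
on such a sum only moves the weight on $\mathbb Z^2$ (`weightedSum_slash`), so transformation laws
become congruences.

For square-free $D$ the cosets of $\Gamma_0(D)$ are represented by matrices with lower row $(D_1,
1+D_1(y-y_0))$, where $D=D_1D_2$, $y$ runs modulo $D_2$ and $y_0$ inverts $D_1$ modulo $D_2$
(`cosetEquiv`). Slashing by such a matrix turns $G_{k,\chi}$ into a multiple of
$G_{k,\chi_1,\bar\chi_2}((z+y)/D_2)$. The multiple is found by comparing Gauss sums
(`GOne_slash_cuspMatrix`). The Fourier expansion of the lattice sums comes from Lipschitz' formula,
and their constant terms from the functional equation (`latticeSum_eq`).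

The Rankin–Cohen bracket commutes with the slash action (`rankinCohen_slash`), so each coset
contributes a bracket of the transformed series. The substitution $z\mapsto (z+y)/D_2$ costs
$D_2^{-e}$, and $g(\chi_2)g(\bar\chi_2)=\chi_2(-1)D_2$ yields the sign and the $1/D_2$ that turns
the sum over $y$ into $U_{D_2}$. The coefficients follow from termwise differentiation, Cauchy
products and orthogonality of roots of unity. There is no constant term because $e\ge 1$. -/

noncomputable section

namespace TraceEis

open UpperHalfPlane hiding I
open Complex Filter Asymptotics Derivative Manifold Finset

/-! ### `q`-series with coefficients of polynomial growth -/

/-- The sequence `a` grows at most polynomially. -/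
def PolyGrowth (a : ℕ → ℂ) : Prop := ∃ A : ℕ, a =O[atTop] fun n => ((n ^ A : ℕ) : ℝ)

/-- The function `z ↦ ∑ aₙ qⁿ` on the upper half plane. -/
def qSeries (a : ℕ → ℂ) (z : ℍ) : ℂ := ∑' n : ℕ, a n * q z ^ n

theorem norm_q_lt_one (z : ℍ) : ‖q z‖ < 1 := norm_exp_two_pi_I_lt_one z

theorem PolyGrowth.natCast_mul {a : ℕ → ℂ} (ha : PolyGrowth a) :
    PolyGrowth fun n => (n : ℂ) * a n := by
  obtain ⟨A, hA⟩ := ha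
  refine ⟨1 + A, ?_⟩
  have h : (fun n : ℕ => (n : ℂ)) =O[atTop] fun n : ℕ => (n : ℝ) :=
    IsBigO.of_norm_le fun n => by simp
  exact (h.mul hA).congr_right fun n => by push_cast; ring

theorem PolyGrowth.pow_mul {a : ℕ → ℂ} (ha : PolyGrowth a) (r : ℕ) :
    PolyGrowth fun n => (n : ℂ) ^ r * a n := by
  induction r with
  | zero => simpa using ha
  | succ r ih =>
    have := ih.natCast_mul
    simpa only [pow_succ', mul_assoc] using this

theorem PolyGrowth.of_norm_le {a : ℕ → ℂ} {C : ℝ} {A : ℕ}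
    (h : ∀ n, 1 ≤ n → ‖a n‖ ≤ C * (n : ℝ) ^ A) : PolyGrowth a :=
  ⟨A, IsBigO.of_bound C <| eventually_atTop.mpr ⟨1, fun n hn => by simpa using h n hn⟩⟩

theorem PolyGrowth.summable_norm {a : ℕ → ℂ} (ha : PolyGrowth a) (z : ℍ) :
    Summable fun n => ‖a n * q z ^ n‖ := by
  obtain ⟨A, hA⟩ := ha
  refine summable_norm_mul_geometric_of_norm_lt_one' (k := A) (norm_q_lt_one z)
    ?_
  simpa [← isBigO_ofReal_right] using hA

theorem PolyGrowth.hasSum {a : ℕ → ℂ} (ha : PolyGrowth a) (z : ℍ) :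
    HasSum (fun n => a n * q z ^ n) (qSeries a z) :=
  (ha.summable_norm z).of_norm.hasSum

theorem PolyGrowth.summableLocallyUniformlyOn {a : ℕ → ℂ} (ha : PolyGrowth a) (j : ℕ) :
    SummableLocallyUniformlyOn (fun n => a n •
      iteratedDerivWithin j (fun z => cexp (2 * Real.pi * I * z) ^ n) upperHalfPlaneSet)
      upperHalfPlaneSet := by
  obtain ⟨A, hA⟩ := ha
  have := summableLocallyUniformlyOn_iteratedDerivWithin_smul_cexp j A (p := 1) one_pos
    (f := a) (by simpa using hA)
  simpa using this

theorem differentiableAt_cexp_pow (c : ℂ) (n : ℕ) (w : ℂ) :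
    DifferentiableAt ℂ (fun z => c * cexp (2 * Real.pi * I * z) ^ n) w := by fun_prop

theorem qSeries_comp_ofComplex (a : ℕ → ℂ) {w : ℂ} (hw : w ∈ upperHalfPlaneSet) :
    (qSeries a ∘ ofComplex) w = ∑' n : ℕ, a n * cexp (2 * Real.pi * I * w) ^ n := by
  simp [qSeries, q, ofComplex_apply_of_im_pos hw]

theorem PolyGrowth.mdifferentiable {a : ℕ → ℂ} (ha : PolyGrowth a) : MDiff (qSeries a) := by
  rw [UpperHalfPlane.mdifferentiable_iff]
  have h := ha.summableLocallyUniformlyOn 0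
  simp only [iteratedDerivWithin_zero] at h
  exact (SummableLocallyUniformlyOn.differentiableOn isOpen_upperHalfPlaneSet h
    fun n r _ => differentiableAt_cexp_pow (a n) n r).congr fun w hw => qSeries_comp_ofComplex a hw

theorem derivWithin_cexp_pow (c : ℂ) (n : ℕ) {w : ℂ} (hw : w ∈ upperHalfPlaneSet) :
    derivWithin (fun z => c * cexp (2 * Real.pi * I * z) ^ n) upperHalfPlaneSet w =
      (2 * Real.pi * I) * (n * c * cexp (2 * Real.pi * I * w) ^ n) := by
  rw [derivWithin_of_isOpen isOpen_upperHalfPlaneSet hw]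
  have h1 : HasDerivAt (fun z => cexp (2 * Real.pi * I * z))
      (cexp (2 * Real.pi * I * w) * (2 * Real.pi * I)) w := by
    simpa using ((hasDerivAt_id w).const_mul (2 * Real.pi * I)).cexp
  rw [((h1.fun_pow n).const_mul c).deriv]
  rcases n with _ | n
  · simp
  · rw [Nat.add_sub_cancel, pow_succ]; ring

/-- The series of derivatives converges locally uniformly, so differentiation is termwise, and $q^n$
is an eigenfunction of the normalized derivative with eigenvalue $n$. -/
theorem PolyGrowth.normalizedDeriv {a : ℕ → ℂ} (ha : PolyGrowth a) :
    normalizedDerivOfComplex (qSeries a) = qSeries fun n => (n : ℂ) * a n := by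
  ext z
  have hz : (z : ℂ) ∈ upperHalfPlaneSet := z.im_pos
  have hd : SummableLocallyUniformlyOn (fun n => derivWithin
      (fun w => a n * cexp (2 * Real.pi * I * w) ^ n) upperHalfPlaneSet) upperHalfPlaneSet := by
    have h := ha.summableLocallyUniformlyOn 1
    refine SummableLocallyUniformlyOn_congr (fun n w hw => ?_) h
    simp only [Pi.smul_apply, smul_eq_mul, iteratedDerivWithin_one]
    rw [derivWithin_cexp_pow _ _ hw]
    have := derivWithin_cexp_pow 1 n hw
    simp only [one_mul] at this
    rw [this]; ring
  have h1 : deriv (qSeries a ∘ ofComplex) z = derivWithin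
      (fun w => ∑' n : ℕ, a n * cexp (2 * Real.pi * I * w) ^ n) upperHalfPlaneSet z := by
    rw [← derivWithin_of_isOpen isOpen_upperHalfPlaneSet hz]
    exact derivWithin_congr (fun w hw => qSeries_comp_ofComplex a hw) (qSeries_comp_ofComplex a hz)
  rw [normalizedDerivOfComplex, h1, derivWithin_tsum isOpen_upperHalfPlaneSet hz
    (fun w hw => (ha.summable_norm ⟨w, hw⟩).of_norm) hd
    (fun n r _ => differentiableAt_cexp_pow (a n) n r),
    tsum_congr fun n => derivWithin_cexp_pow (a n) n hz, tsum_mul_left, ← mul_assoc,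
    inv_mul_cancel₀ two_pi_I_ne_zero, one_mul]
  rfl

theorem PolyGrowth.normalizedDeriv_iterate {a : ℕ → ℂ} (ha : PolyGrowth a) (r : ℕ) :
    normalizedDerivOfComplex^[r] (qSeries a) = qSeries fun n => (n : ℂ) ^ r * a n := by
  induction r with
  | zero => simp
  | succ r ih =>
    rw [Function.iterate_succ_apply', ih, (ha.pow_mul r).normalizedDeriv]
    simp only [pow_succ', mul_assoc]

/-! ### Rankin–Cohen brackets of `q`-series -/

/-- The `n`-th coefficient of the bracket `[∑ aₙ qⁿ, ∑ bₙ qⁿ]_e`. -/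
def bracketCoeff (ℓ k e : ℕ) (a b : ℕ → ℂ) (n : ℕ) : ℂ :=
  ∑ x ∈ antidiagonal n, a x.1 * b x.2 * cCoeff ℓ k e x.1 x.2

/-- Each term of the bracket is a product of two absolutely convergent $q$-series, expanded as a
Cauchy product; collecting the powers $a_1^r a_2^{e-r}$ over $r$ produces `cCoeff`. -/
theorem hasSum_rankinCohen {a b : ℕ → ℂ} (ha : PolyGrowth a) (hb : PolyGrowth b) (ℓ k e : ℕ)
    (z : ℍ) : HasSum (fun n => bracketCoeff ℓ k e a b n * q z ^ n)
      (rankinCohen ℓ k e (qSeries a) (qSeries b) z) := by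
  have key (r s : ℕ) : HasSum (fun n : ℕ => ∑ x ∈ antidiagonal n,
      ((x.1 : ℂ) ^ r * a x.1 * q z ^ x.1) * ((x.2 : ℂ) ^ s * b x.2 * q z ^ x.2))
      (normalizedDerivOfComplex^[r] (qSeries a) z *
        normalizedDerivOfComplex^[s] (qSeries b) z) := by
    rw [ha.normalizedDeriv_iterate, hb.normalizedDeriv_iterate, qSeries, qSeries,
      tsum_mul_tsum_eq_tsum_sum_antidiagonal_of_summable_norm ((ha.pow_mul r).summable_norm z)
        ((hb.pow_mul s).summable_norm z)]
    exact (summable_norm_sum_mul_antidiagonal_of_summable_norm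
      ((ha.pow_mul r).summable_norm z) ((hb.pow_mul s).summable_norm z)).of_norm.hasSum
  have := hasSum_sum (s := range (e + 1)) fun r _ => (key r (e - r)).mul_left
    ((-1 : ℂ) ^ r * ((e + ℓ - 1).choose (e - r) : ℂ) * ((e + k - 1).choose r : ℂ))
  convert! this using 1
  · ext n
    simp only [bracketCoeff, cCoeff, mul_sum, sum_mul]
    rw [sum_comm]
    refine sum_congr rfl fun r _ => sum_congr rfl fun x hx => ?_
    rw [← mem_antidiagonal.mp hx, pow_add]
    ring
  · simp only [rankinCohen, mul_assoc]

/-- For $e\ge1$ the exponents $r$ and $e-r$ cannot both vanish, so every term has a factor $0$. This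
is why the trace has no constant term. -/
theorem cCoeff_zero {ℓ k e : ℕ} (he : 1 ≤ e) : cCoeff ℓ k e 0 0 = 0 := by
  refine sum_eq_zero fun r hr => ?_
  rcases Nat.eq_zero_or_pos r with rfl | h
  · simp [zero_pow (show e ≠ 0 by omega)]
  · simp [zero_pow h.ne']

/-! ### The operator `U` on `q`-series -/

theorem q_shiftDiv (m : ℕ) [NeZero m] (v : ℕ) (z : ℍ) :
    q (shiftDiv m v z) = cexp (2 * Real.pi * I * z / m) * cexp (2 * Real.pi * I / m) ^ v := by
  rw [q, ← Complex.exp_nat_mul, ← Complex.exp_add]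
  congr 1
  simp only [shiftDiv]
  have : (m : ℂ) ≠ 0 := NeZero.ne _
  field_simp

theorem sum_exp_pow_eq (m : ℕ) [NeZero m] (n : ℕ) :
    ∑ v ∈ range m, (cexp (2 * Real.pi * I / m) ^ n) ^ v = if m ∣ n then (m : ℂ) else 0 := by
  have hp := Complex.isPrimitiveRoot_exp m (NeZero.ne m)
  split_ifs with h
  · rw [(hp.pow_eq_one_iff_dvd n).mpr h]; simp
  · have h1 : cexp (2 * Real.pi * I / m) ^ n ≠ 1 := fun h' => h ((hp.pow_eq_one_iff_dvd n).mp h')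
    rw [geom_sum_eq h1, ← pow_mul, mul_comm n, pow_mul, hp.pow_eq_one]
    simp

/-- Averaging over $v$ modulo $m$ kills the exponents prime to divisibility by $m$, by orthogonality
of the $m$-th roots of unity; the surviving ones are reindexed by $n\mapsto nm$. -/
theorem hasSum_U {f : ℍ → ℂ} {b : ℕ → ℂ} (h : ∀ z, HasSum (fun n => b n * q z ^ n) (f z))
    (m : ℕ) [NeZero m] (z : ℍ) : HasSum (fun n => b (n * m) * q z ^ n) (U m f z) := by
  have h1 := (hasSum_sum (s := range m) fun v _ => h (shiftDiv m v z)).mul_left (1 / (m : ℂ))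
  have hm : (m : ℂ) ≠ 0 := NeZero.ne _
  have h2 (n : ℕ) : 1 / (m : ℂ) * ∑ v ∈ range m, b n * q (shiftDiv m v z) ^ n =
      if m ∣ n then b n * cexp (2 * Real.pi * I * z / m) ^ n else 0 := by
    have : ∀ v, b n * q (shiftDiv m v z) ^ n =
        b n * cexp (2 * Real.pi * I * z / m) ^ n * (cexp (2 * Real.pi * I / m) ^ n) ^ v := by
      intro v
      rw [q_shiftDiv, mul_pow, ← pow_mul, ← pow_mul, mul_comm v n, mul_assoc (b n)]
    simp_rw [this, ← mul_sum, sum_exp_pow_eq]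
    split_ifs
    · field_simp
    · simp
  simp_rw [h2] at h1
  have hinj : Function.Injective fun n : ℕ => n * m := fun x y hxy =>
    Nat.eq_of_mul_eq_mul_right (NeZero.pos m) hxy
  have h3 := (hinj.hasSum_iff (f := fun n => if m ∣ n then
    b n * cexp (2 * Real.pi * I * z / m) ^ n else 0) (a := U m f z) fun n hn => by
      rw [if_neg]
      rintro ⟨c, rfl⟩
      exact hn ⟨c, mul_comm _ _⟩).mpr h1
  refine h3.congr_fun fun n => ?_
  simp only [Function.comp_apply, dvd_mul_left, if_true]
  rw [q, ← Complex.exp_nat_mul, ← Complex.exp_nat_mul]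
  congr 2
  push_cast
  field_simp

/-! ### The divisor sums grow polynomially -/

/-- There are at most $n$ divisors and each term is at most $n^{k-1}$. The index $n=0$ carries an
$L$-value and is irrelevant to growth. -/
theorem norm_sigmaTwo_le {M N : ℕ} [NeZero M] [NeZero N] {k : ℕ} (φ : DirichletCharacter ℂ M)
    (ψ : DirichletCharacter ℂ N) {n : ℕ} (hn : 1 ≤ n) (hk : 1 ≤ k) :
    ‖sigmaTwo k φ ψ n‖ ≤ 1 * (n : ℝ) ^ k := by
  rw [sigmaTwo, if_neg (by omega)]
  have h (d : ℕ × ℕ) (hd : d ∈ n.divisorsAntidiagonal) :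
      ‖φ (d.1 : ZMod M) * ψ (d.2 : ZMod N) * (d.1 : ℂ) ^ (k - 1)‖ ≤ (n : ℝ) ^ (k - 1) := by
    rw [norm_mul, norm_mul, norm_pow, Complex.norm_natCast]
    have h1 := φ.norm_le_one (d.1 : ZMod M)
    have h2 := ψ.norm_le_one (d.2 : ZMod N)
    have h3 : (d.1 : ℝ) ≤ n := by
      exact_mod_cast Nat.le_of_dvd (by omega) (Dvd.intro _ (Nat.mem_divisorsAntidiagonal.mp hd).1)
    calc _ ≤ 1 * 1 * (d.1 : ℝ) ^ (k - 1) := by gcongr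
      _ ≤ _ := by rw [one_mul, one_mul]; gcongr
  refine (norm_sum_le_of_le _ h).trans ?_
  rw [sum_const, nsmul_eq_mul, one_mul, ← Nat.sub_add_cancel hk, pow_succ', Nat.add_sub_cancel]
  gcongr
  rw [← Nat.map_div_right_divisors, card_map]
  exact_mod_cast Nat.card_divisors_le_self n

theorem polyGrowth_sigmaTwo {M N : ℕ} [NeZero M] [NeZero N] {k : ℕ} (hk : 1 ≤ k)
    (φ : DirichletCharacter ℂ M) (ψ : DirichletCharacter ℂ N) : PolyGrowth (sigmaTwo k φ ψ) :=
  PolyGrowth.of_norm_le fun _ hn => norm_sigmaTwo_le φ ψ hn hk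

end TraceEis

end

noncomputable section

namespace TraceEis

open UpperHalfPlane hiding I
open Complex Filter Asymptotics Derivative Manifold Finset Topology
open scoped Nat

/-! ### Rankin–Cohen brackets and affine substitutions -/

theorem normalizedDeriv_smul (c : ℂ) (f : ℍ → ℂ) :
    normalizedDerivOfComplex (c • f) = c • normalizedDerivOfComplex f := by
  ext z
  simp only [normalizedDerivOfComplex, Pi.smul_apply, smul_eq_mul]
  rw [show (c • f) ∘ ofComplex = fun w => c * (f ∘ ofComplex) w from rfl, deriv_const_mul_field]
  ring

theorem normalizedDeriv_iterate_smul (c : ℂ) (f : ℍ → ℂ) (r : ℕ) :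
    normalizedDerivOfComplex^[r] (c • f) = c • normalizedDerivOfComplex^[r] f := by
  induction r with
  | zero => rfl
  | succ r ih => rw [Function.iterate_succ_apply', Function.iterate_succ_apply', ih,
      normalizedDeriv_smul]

theorem rankinCohen_smul_smul (a b e : ℕ) (c d : ℂ) (f g : ℍ → ℂ) :
    rankinCohen a b e (c • f) (d • g) = (c * d) • rankinCohen a b e f g := by
  ext z
  simp only [rankinCohen, normalizedDeriv_iterate_smul, Pi.smul_apply, smul_eq_mul, mul_sum]
  exact sum_congr rfl fun r _ => by ring

theorem normalizedDeriv_comp_shiftDiv (m : ℕ) [NeZero m] (v : ℕ) (f : ℍ → ℂ) :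
    normalizedDerivOfComplex (f ∘ shiftDiv m v) =
      (m : ℂ)⁻¹ • (normalizedDerivOfComplex f ∘ shiftDiv m v) := by
  ext z
  have h : (f ∘ shiftDiv m v) ∘ ofComplex =ᶠ[𝓝 (z : ℂ)]
      fun w => (f ∘ ofComplex) ((m : ℂ)⁻¹ * w + v / m) := by
    filter_upwards [isOpen_upperHalfPlaneSet.mem_nhds z.im_pos] with w hw
    have : (m : ℂ)⁻¹ * w + v / m = (shiftDiv m v (ofComplex w) : ℍ) := by
      simp only [shiftDiv, ofComplex_apply_of_im_pos hw]
      rw [add_div, inv_mul_eq_div]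
    simp only [Function.comp_apply]
    rw [this, ofComplex_apply]
  simp only [normalizedDerivOfComplex, Pi.smul_apply, smul_eq_mul, Function.comp_apply]
  rw [h.deriv_eq, deriv_comp_mul_left (m : ℂ)⁻¹ (fun w => (f ∘ ofComplex) (w + v / m)),
    deriv_comp_add_const, smul_eq_mul]
  have : (m : ℂ)⁻¹ * z + v / m = (shiftDiv m v z : ℍ) := by
    simp only [shiftDiv]
    rw [add_div, inv_mul_eq_div]
  rw [this]
  ring

theorem normalizedDeriv_iterate_comp_shiftDiv (m : ℕ) [NeZero m] (v : ℕ) (f : ℍ → ℂ) (r : ℕ) :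
    normalizedDerivOfComplex^[r] (f ∘ shiftDiv m v) =
      ((m : ℂ) ^ r)⁻¹ • (normalizedDerivOfComplex^[r] f ∘ shiftDiv m v) := by
  induction r with
  | zero => simp
  | succ r ih =>
    rw [Function.iterate_succ_apply', Function.iterate_succ_apply', ih, normalizedDeriv_smul,
      normalizedDeriv_comp_shiftDiv, smul_smul, pow_succ, mul_inv]

/-- Every term of the bracket carries $e$ derivatives in total, and the chain rule gives $1/m$ for
each. This is the source of the factor $D_2^{-e}$. -/
theorem rankinCohen_comp_shiftDiv (a b e m : ℕ) [NeZero m] (v : ℕ) (f g : ℍ → ℂ) :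
    rankinCohen a b e (f ∘ shiftDiv m v) (g ∘ shiftDiv m v) =
      ((m : ℂ) ^ e)⁻¹ • (rankinCohen a b e f g ∘ shiftDiv m v) := by
  ext z
  simp only [rankinCohen, normalizedDeriv_iterate_comp_shiftDiv, Pi.smul_apply, smul_eq_mul,
    mul_sum, Function.comp_apply]
  refine sum_congr rfl fun r hr => ?_
  rw [← Nat.add_sub_of_le (Nat.lt_succ_iff.mp (mem_range.mp hr)), pow_add, mul_inv,
    Nat.add_sub_cancel_left]
  ring

/-! ### Rankin–Cohen brackets and the slash action -/

/-- The coefficients in the iterated derivative of `f ∣[a + 1] γ`. -/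
def slashCoeff (a n s : ℕ) : ℂ := n.choose s * ((n + a)! / (s + a)!)

theorem slashCoeff_zero_right (a n : ℕ) :
    slashCoeff a (n + 1) 0 = slashCoeff a n 0 * (n + a + 1) := by
  simp only [slashCoeff, Nat.choose_zero_right, zero_add, add_right_comm n 1 a, Nat.factorial_succ]
  push_cast
  ring

theorem slashCoeff_succ_succ (a n s : ℕ) :
    slashCoeff a (n + 1) (s + 1) =
      slashCoeff a n (s + 1) * (n + a + s + 2) + slashCoeff a n s := by
  have h := congrArg (Nat.cast (R := ℂ)) (Nat.choose_succ_right_eq n s)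
  rcases le_or_gt s n with hs | hs
  · push_cast [Nat.cast_sub hs] at h
    simp only [slashCoeff, Nat.choose_succ_succ, add_right_comm _ 1 a, Nat.factorial_succ]
    have h1 : ((s + a)! : ℂ) ≠ 0 := by exact_mod_cast (s + a).factorial_ne_zero
    have h2 : ((s : ℂ) + a + 1) ≠ 0 := by exact_mod_cast (s + a).succ_ne_zero
    push_cast
    field_simp
    linear_combination (-((n + a)! : ℂ)) * h
  · simp [slashCoeff, Nat.choose_eq_zero_of_lt hs,
    Nat.choose_eq_zero_of_lt (hs.trans s.lt_succ_self),
      Nat.choose_eq_zero_of_lt (Nat.succ_lt_succ hs)]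

/-- The logarithmic derivative of the factor of automorphy in weight `-1`, up to normalization. -/
def autoFactor (γ : SL(2, ℤ)) (z : ℍ) : ℂ :=
  -((2 * Real.pi * I)⁻¹ * (((γ 1 0 : ℤ) : ℂ) / denom γ z))

theorem hasDerivAt_autoFactor (γ : SL(2, ℤ)) (z : ℍ) :
    HasDerivAt (autoFactor γ ∘ ofComplex) ((2 * Real.pi * I) * autoFactor γ z ^ 2) z := by
  have h1 := (hasDerivAt_denom_zpow (γ : GL (Fin 2) ℝ) (-1) z).const_mul
    (-((2 * Real.pi * I)⁻¹ * ((γ 1 0 : ℤ) : ℂ)))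
  have h2 : autoFactor γ ∘ ofComplex =ᶠ[𝓝 (z : ℂ)]
      fun w => -((2 * Real.pi * I)⁻¹ * ((γ 1 0 : ℤ) : ℂ)) * denom γ w ^ (-1 : ℤ) := by
    filter_upwards [isOpen_upperHalfPlaneSet.mem_nhds z.im_pos] with w hw
    simp only [Function.comp_apply, autoFactor, ofComplex_apply_of_im_pos hw]
    rw [zpow_neg_one]
    ring
  refine (h1.congr_of_eventuallyEq h2).congr_deriv ?_
  have hd := denom_ne_zero γ z
  rw [show (-1 - 1 : ℤ) = -2 by norm_num, zpow_neg, autoFactor]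
  simp
  field_simp
  rw [I_sq]
  ring

theorem mdifferentiable_autoFactor (γ : SL(2, ℤ)) : MDiff (autoFactor γ) := fun z =>
  mdifferentiableAt_iff.mpr (hasDerivAt_autoFactor γ z).differentiableAt

/-- The relation $A'=A^2$ makes iterated derivatives of a slashed function polynomials in $A$ with
coefficients in closed form. -/
theorem normalizedDeriv_autoFactor (γ : SL(2, ℤ)) :
    normalizedDerivOfComplex (autoFactor γ) = autoFactor γ ^ 2 := by
  ext z
  rw [normalizedDerivOfComplex, (hasDerivAt_autoFactor γ z).deriv, ← mul_assoc,
    inv_mul_cancel₀ two_pi_I_ne_zero, one_mul, Pi.pow_apply]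

theorem mdifferentiable_SL_slash {f : ℍ → ℂ} (hf : MDiff f) (k : ℤ) (γ : SL(2, ℤ)) :
    MDiff (f ∣[k] γ) := by
  rw [ModularForm.SL_slash]
  exact hf.slash k _

theorem mdifferentiable_normalizedDeriv_iterate {f : ℍ → ℂ} (hf : MDiff f) (r : ℕ) :
    MDiff (normalizedDerivOfComplex^[r] f) := by
  induction r with
  | zero => exact hf
  | succ r ih =>
    rw [Function.iterate_succ_apply']
    exact normalizedDerivOfComplex_mdifferentiable ih

theorem normalizedDeriv_slash {f : ℍ → ℂ} (hf : MDiff f) (k : ℤ) (γ : SL(2, ℤ)) :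
    normalizedDerivOfComplex (f ∣[k] γ) =
      normalizedDerivOfComplex f ∣[k + 2] γ + (k : ℂ) • (autoFactor γ * f ∣[k] γ) := by
  ext z
  rw [normalizedDerivOfComplex_SL_slash hf]
  simp [autoFactor]
  ring

theorem mdifferentiable_sum {ι : Type*} {s : Finset ι} {f : ι → ℍ → ℂ}
    (hf : ∀ i ∈ s, MDiff (f i)) : MDiff (∑ i ∈ s, f i) := by
  classical
  induction s using Finset.induction_on with
  | empty => exact mdifferentiable_const
  | insert i s hi ih =>
    rw [sum_insert hi]
    exact (hf i (mem_insert_self i s)).add (ih fun j hj => hf j (mem_insert_of_mem hj))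

theorem normalizedDeriv_sum {ι : Type*} {s : Finset ι} {f : ι → ℍ → ℂ}
    (hf : ∀ i ∈ s, MDiff (f i)) :
    normalizedDerivOfComplex (∑ i ∈ s, f i) = ∑ i ∈ s, normalizedDerivOfComplex (f i) := by
  classical
  induction s using Finset.induction_on with
  | empty => exact normalizedDerivOfComplex_const 0
  | insert i s hi ih =>
    rw [sum_insert hi, sum_insert hi, normalizedDerivOfComplex_add _ _
      (hf i (mem_insert_self i s)) (mdifferentiable_sum fun j hj => hf j (mem_insert_of_mem hj)),
      ih fun j hj => hf j (mem_insert_of_mem hj)]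

theorem normalizedDeriv_iterate_slash {f : ℍ → ℂ} (hf : MDiff f) (a : ℕ) (γ : SL(2, ℤ)) (n : ℕ) :
    normalizedDerivOfComplex^[n] (f ∣[((a + 1 : ℕ) : ℤ)] γ) =
      ∑ s ∈ range (n + 1), slashCoeff a n s • (autoFactor γ ^ (n - s) *
        normalizedDerivOfComplex^[s] f ∣[((a + 1 + 2 * s : ℕ) : ℤ)] γ) := by
  induction n with
  | zero => simp [slashCoeff, Nat.factorial_ne_zero]
  | succ n ih =>
    set G : ℕ → ℍ → ℂ :=
      fun s => normalizedDerivOfComplex^[s] f ∣[((a + 1 + 2 * s : ℕ) : ℤ)] γ with hG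
    change _ = ∑ s ∈ range (n + 1 + 1), slashCoeff a (n + 1) s • (autoFactor γ ^ (n + 1 - s) * G s)
    have hGd (s : ℕ) : MDiff (G s) :=
      mdifferentiable_SL_slash (mdifferentiable_normalizedDeriv_iterate hf s) _ _
    have hDG (s : ℕ) : normalizedDerivOfComplex (G s) =
        G (s + 1) + ((a + 1 + 2 * s : ℕ) : ℂ) • (autoFactor γ * G s) := by
      simp only [hG]
      rw [normalizedDeriv_slash (mdifferentiable_normalizedDeriv_iterate hf s),
        Function.iterate_succ_apply']
      push_cast
      rfl
    have hp (m : ℕ) : MDiff (autoFactor γ ^ m) := (mdifferentiable_autoFactor γ).pow m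
    -- The factor $n+a+s+1$ is $(n-s)$ from differentiating $A^{n-s}$ plus the weight $a+1+2s$ of `G
    -- s`.
    have hterm (s : ℕ) (hs : s ∈ range (n + 1)) :
        normalizedDerivOfComplex (slashCoeff a n s • (autoFactor γ ^ (n - s) * G s)) =
        (slashCoeff a n s * (n + a + s + 1)) • (autoFactor γ ^ (n + 1 - s) * G s) +
          slashCoeff a n s • (autoFactor γ ^ (n - s) * G (s + 1)) := by
      have hs' : s ≤ n := Nat.lt_succ_iff.mp (mem_range.mp hs)
      obtain ⟨m, rfl⟩ := Nat.exists_eq_add_of_le hs'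
      rw [normalizedDeriv_smul, normalizedDerivOfComplex_mul _ _ (hp _) (hGd s),
        normalizedDerivOfComplex_pow _ _ (mdifferentiable_autoFactor γ),
        normalizedDeriv_autoFactor, hDG]
      ext z
      rw [Nat.add_sub_cancel_left, show s + m + 1 - s = m + 1 by omega]
      simp only [Pi.smul_apply, Pi.add_apply, Pi.mul_apply, Pi.pow_apply, smul_eq_mul,
        Pi.natCast_apply]
      rcases m with _ | m
      · push_cast; ring
      · rw [Nat.add_sub_cancel]; push_cast; ring
    rw [Function.iterate_succ_apply', ih, normalizedDeriv_sum
      (fun s _ => ((hp _).mul (hGd s)).const_smul (slashCoeff a n s)), sum_congr rfl hterm,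
      sum_add_distrib]
    -- The added term $s=n+1$ vanishes because $\binom{n}{n+1}=0$; it aligns the two ranges for the
    -- recursion.
    have h1 : ∑ s ∈ range (n + 1), (slashCoeff a n s * (n + a + s + 1)) •
          (autoFactor γ ^ (n + 1 - s) * G s) =
        ∑ s ∈ range (n + 1 + 1), (slashCoeff a n s * (n + a + s + 1)) •
          (autoFactor γ ^ (n + 1 - s) * G s) := by
      rw [sum_range_succ _ (n + 1)]
      simp [slashCoeff]
    rw [h1, sum_range_succ', sum_range_succ' _ (n + 1), add_right_comm, ← sum_add_distrib]
    congr 1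
    · refine sum_congr rfl fun s _ => ?_
      rw [slashCoeff_succ_succ, show n + 1 - (s + 1) = n - s by omega]
      ext z
      simp only [Pi.smul_apply, Pi.add_apply, Pi.mul_apply, Pi.pow_apply, smul_eq_mul]
      push_cast
      ring
    · rw [slashCoeff_zero_right]
      simp

/-- Here $a$, $b$ are the weights minus one. The product of the binomials is $(e+a)!\,(e+b)!$
divided by $r!\,(r+a)!\,s!\,(s+b)!$ with $s=e-r$, so the bracket is a coefficient of $F(-X)G(X)$ for
the Cohen–Kuznetsov series $F$, $G$. -/
theorem sum_choose_eq_coeff (a b e : ℕ) (u v : ℕ → ℂ) :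
    ∑ r ∈ range (e + 1), (-1 : ℂ) ^ r * ((e + (a + 1) - 1).choose (e - r) : ℂ) *
        ((e + (b + 1) - 1).choose r : ℂ) * u r * v (e - r) =
      (e + a)! * (e + b)! * PowerSeries.coeff e
        (PowerSeries.rescale (-1) (PowerSeries.mk fun n => u n / (n ! * (n + a)!)) *
          PowerSeries.mk fun n => v n / (n ! * (n + b)!)) := by
  rw [PowerSeries.coeff_mul, Nat.sum_antidiagonal_eq_sum_range_succ_mk, mul_sum]
  refine sum_congr rfl fun r hr => ?_
  have hr' : r ≤ e := Nat.lt_succ_iff.mp (mem_range.mp hr)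
  obtain ⟨s, rfl⟩ := Nat.exists_eq_add_of_le hr'
  rw [PowerSeries.coeff_rescale, PowerSeries.coeff_mk, PowerSeries.coeff_mk,
    Nat.add_sub_cancel_left, show r + s + (a + 1) - 1 = s + (r + a) by omega,
    show r + s + (b + 1) - 1 = r + (s + b) by omega, Nat.cast_add_choose, Nat.cast_add_choose,
    show r + s + a = s + (r + a) by omega, show r + s + b = r + (s + b) by omega]
  have := fun n : ℕ => (Nat.cast_ne_zero (R := ℂ)).mpr n.factorial_ne_zero
  field_simp [this]

/-- Since `slashCoeff a n s` divided by $n!\,(n+a)!$ is $1/((n-s)!\,s!\,(s+a)!)$, slashing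
multiplies the Cohen–Kuznetsov series by $e^{tX}$. -/
theorem mk_slash_eq (a : ℕ) (t : ℂ) (u : ℕ → ℂ) :
    (PowerSeries.mk fun n => (∑ s ∈ range (n + 1), slashCoeff a n s * (t ^ (n - s) * u s)) /
      (n ! * (n + a)! : ℂ)) =
    PowerSeries.rescale t (PowerSeries.exp ℂ) *
      PowerSeries.mk fun n => u n / (n ! * (n + a)!) := by
  ext n
  rw [PowerSeries.coeff_mk, mul_comm (PowerSeries.rescale t _), PowerSeries.coeff_mul,
    Nat.sum_antidiagonal_eq_sum_range_succ_mk, sum_div]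
  refine sum_congr rfl fun s hs => ?_
  have hs' : s ≤ n := Nat.lt_succ_iff.mp (mem_range.mp hs)
  obtain ⟨m, rfl⟩ := Nat.exists_eq_add_of_le hs'
  rw [PowerSeries.coeff_rescale, PowerSeries.coeff_mk, PowerSeries.coeff_exp,
    Nat.add_sub_cancel_left, slashCoeff, Nat.cast_add_choose]
  have := fun n : ℕ => (Nat.cast_ne_zero (R := ℂ)).mpr n.factorial_ne_zero
  simp only [one_div, map_inv₀, map_natCast]
  field_simp [this]

theorem rescale_neg_exp_mul (t : ℂ) (f g : PowerSeries ℂ) :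
    PowerSeries.rescale (-1) (PowerSeries.rescale t (PowerSeries.exp ℂ) * f) *
      (PowerSeries.rescale t (PowerSeries.exp ℂ) * g) = PowerSeries.rescale (-1) f * g := by
  have h : PowerSeries.rescale (-1) (PowerSeries.rescale t (PowerSeries.exp ℂ)) *
      PowerSeries.rescale t (PowerSeries.exp ℂ) = 1 := by
    rw [PowerSeries.rescale_rescale, PowerSeries.exp_mul_exp_eq_exp_add]
    simp
  rw [map_mul]
  linear_combination (PowerSeries.rescale (-1) f * g) * h

/-- The factors $e^{-AX}$ and $e^{AX}$ acquired by $F(-X)$ and $G(X)$ cancel, so all the terms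
violating modularity disappear from the bracket. -/
theorem rankinCohen_slash {f g : ℍ → ℂ} (hf : MDiff f) (hg : MDiff g) (a b e : ℕ) (ha : 1 ≤ a)
    (hb : 1 ≤ b) (γ : SL(2, ℤ)) :
    rankinCohen a b e f g ∣[((a + b + 2 * e : ℕ) : ℤ)] γ =
      rankinCohen a b e (f ∣[(a : ℤ)] γ) (g ∣[(b : ℤ)] γ) := by
  obtain ⟨a, rfl⟩ := Nat.exists_eq_add_of_le' ha
  obtain ⟨b, rfl⟩ := Nat.exists_eq_add_of_le' hb
  ext z
  rw [ModularForm.SL_slash_apply]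
  simp only [rankinCohen, normalizedDeriv_iterate_slash hf, normalizedDeriv_iterate_slash hg,
    Finset.sum_apply, Pi.smul_apply, smul_eq_mul, Pi.mul_apply, Pi.pow_apply]
  rw [sum_choose_eq_coeff a b e (fun n => ∑ s ∈ range (n + 1), slashCoeff a n s *
      (autoFactor γ z ^ (n - s) *
        (normalizedDerivOfComplex^[s] f ∣[((a + 1 + 2 * s : ℕ) : ℤ)] γ) z))
      (fun n => ∑ s ∈ range (n + 1), slashCoeff b n s *
      (autoFactor γ z ^ (n - s) *
        (normalizedDerivOfComplex^[s] g ∣[((b + 1 + 2 * s : ℕ) : ℤ)] γ) z)),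
    mk_slash_eq a (autoFactor γ z)
      (fun s => (normalizedDerivOfComplex^[s] f ∣[((a + 1 + 2 * s : ℕ) : ℤ)] γ) z),
    mk_slash_eq b (autoFactor γ z)
      (fun s => (normalizedDerivOfComplex^[s] g ∣[((b + 1 + 2 * s : ℕ) : ℤ)] γ) z),
    rescale_neg_exp_mul, ← sum_choose_eq_coeff]
  simp only [ModularForm.SL_slash_apply, sum_mul]
  refine sum_congr rfl fun r hr => ?_
  have hr' : r ≤ e := Nat.lt_succ_iff.mp (mem_range.mp hr)
  obtain ⟨s, rfl⟩ := Nat.exists_eq_add_of_le hr'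
  have hd := denom_ne_zero γ z
  rw [Nat.add_sub_cancel_left, show ((a + 1 + (b + 1) + 2 * (r + s) : ℕ) : ℤ) =
    ((a + 1 + 2 * r : ℕ) : ℤ) + ((b + 1 + 2 * s : ℕ) : ℤ) by push_cast; ring, neg_add,
    zpow_add₀ hd]
  ring_nf

end TraceEis

end

noncomputable section

namespace TraceEis

open UpperHalfPlane hiding I
open Complex Filter Finset

/-! ### Gauss sums and the functional equation -/

theorem isPrimitive_inv {M : ℕ} {φ : DirichletCharacter ℂ M} (hφ : φ.IsPrimitive) :
    φ⁻¹.IsPrimitive := by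
  rw [DirichletCharacter.isPrimitive_def, DirichletCharacter.conductor_inv]
  exact hφ

theorem apply_neg_one_mul_self {M : ℕ} (φ : DirichletCharacter ℂ M) : φ (-1) * φ (-1) = 1 := by
  rw [← map_mul]; simp

theorem inv_apply_neg_one {M : ℕ} (φ : DirichletCharacter ℂ M) : φ⁻¹ (-1) = φ (-1) := by
  rw [MulChar.inv_apply_eq_inv', inv_eq_iff_eq_inv]
  exact eq_inv_of_mul_eq_one_left (apply_neg_one_mul_self φ)

section GaussSum

variable {M : ℕ} [NeZero M]

/-- For primitive $\varphi$ the discrete Fourier transform exchanges $\varphi$ and $\bar\varphi$ up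
to Gauss sums. Applying it twice and evaluating at $-1$ gives $M$. -/
theorem gaussSum_mul_gaussSum_inv {φ : DirichletCharacter ℂ M} (hφ : φ.IsPrimitive) :
    gaussSum φ ZMod.stdAddChar * gaussSum φ⁻¹ ZMod.stdAddChar = φ (-1) * M := by
  have h1 : ZMod.dft (φ : ZMod M → ℂ) =
      fun x => (φ (-1) * gaussSum φ ZMod.stdAddChar) * φ⁻¹ x := by
    ext x
    rw [hφ.fourierTransform_eq_inv_mul_gaussSum, neg_eq_neg_one_mul, map_mul, inv_apply_neg_one]
    ring
  have h2 := congrFun (ZMod.dft_dft (φ : ZMod M → ℂ)) (-1)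
  rw [h1, ZMod.dft_const_mul] at h2
  simp only [neg_neg, map_one, smul_eq_mul, mul_one] at h2
  rw [(isPrimitive_inv hφ).fourierTransform_eq_inv_mul_gaussSum, neg_neg, map_one, one_mul] at h2
  linear_combination φ (-1) * h2 -
    (gaussSum φ ZMod.stdAddChar * gaussSum φ⁻¹ ZMod.stdAddChar) * apply_neg_one_mul_self φ

theorem gaussSum_ne_zero {φ : DirichletCharacter ℂ M} (hφ : φ.IsPrimitive) :
    gaussSum φ ZMod.stdAddChar ≠ 0 := by
  intro h
  have h1 := gaussSum_mul_gaussSum_inv hφ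
  rw [h, zero_mul, eq_comm, mul_eq_zero] at h1
  rcases h1 with h1 | h1
  · have := apply_neg_one_mul_self φ
    simp [h1] at this
  · exact NeZero.ne (M : ℂ) h1

theorem sum_inv_mul_stdAddChar {φ : DirichletCharacter ℂ M} (hφ : φ.IsPrimitive) (r : ZMod M) :
    ∑ a : ZMod M, φ⁻¹ a * ZMod.stdAddChar (a * r) = φ r * gaussSum φ⁻¹ ZMod.stdAddChar := by
  have := gaussSum_mulShift_of_isPrimitive ZMod.stdAddChar (isPrimitive_inv hφ) r
  rw [inv_inv] at this
  rw [← this, gaussSum]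
  exact sum_congr rfl fun a _ => by rw [AddChar.mulShift_apply, mul_comm r]

theorem LFunction_one_sub_natCast {φ : DirichletCharacter ℂ M} (hφ : φ.IsPrimitive) {k : ℕ}
    (hk : 2 ≤ k) :
    φ.LFunction (1 - k) = (M : ℂ) ^ (k - 1) * (2 * Real.pi : ℂ)⁻¹ ^ k * (k - 1).factorial *
      gaussSum φ ZMod.stdAddChar * φ⁻¹.LFunction k * (I ^ k * φ (-1) + (I ^ k)⁻¹) := by
  have h := ZMod.LFunction_one_sub (φ : ZMod M → ℂ) (s := k)
    (fun n => by
      rw [ne_eq, eq_neg_iff_add_eq_zero]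
      exact_mod_cast (by omega : k + n ≠ 0)) (Or.inr (by exact_mod_cast (by omega : k ≠ 1)))
  -- The transforms of $\varphi$ and of $x\mapsto\varphi(-x)$ are both multiples of $\bar\varphi$,
  -- differing by $\varphi(-1)$; hence a single $L$-value on the right.
  have h1 : ZMod.dft (φ : ZMod M → ℂ) =
      (φ (-1) * gaussSum φ ZMod.stdAddChar) • fun x => φ⁻¹ x := by
    ext x
    rw [hφ.fourierTransform_eq_inv_mul_gaussSum, neg_eq_neg_one_mul, map_mul, inv_apply_neg_one,
      Pi.smul_apply, smul_eq_mul]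
    ring
  have h2 : ZMod.dft (fun x => φ (-x)) = gaussSum φ ZMod.stdAddChar • fun x => φ⁻¹ x := by
    ext x
    simp only [ZMod.dft_comp_neg]
    rw [hφ.fourierTransform_eq_inv_mul_gaussSum, neg_neg,
      Pi.smul_apply, smul_eq_mul, mul_comm]
  have h3 (c : ℂ) (Φ : ZMod M → ℂ) (s : ℂ) : ZMod.LFunction (c • Φ) s = c * ZMod.LFunction Φ s := by
    simp only [ZMod.LFunction, Pi.smul_apply, smul_eq_mul, mul_assoc, mul_sum, mul_left_comm c]
  have h4 : cexp (Real.pi * I * k / 2) = I ^ k := by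
    rw [show (Real.pi * I * k / 2 : ℂ) = k * (Real.pi / 2 * I) by ring, Complex.exp_nat_mul,
      Complex.exp_pi_div_two_mul_I]
  have h5 : cexp (-Real.pi * I * k / 2) = (I ^ k)⁻¹ := by
    rw [← h4, ← Complex.exp_neg]; congr 1; ring
  rw [h1, h2, h3, h3, h4, h5, show (k : ℂ) = ((k - 1 : ℕ) : ℂ) + 1 by
    push_cast [Nat.cast_sub (show 1 ≤ k by omega)]; ring, Complex.Gamma_nat_eq_factorial,
    add_sub_cancel_right, Complex.cpow_natCast, Complex.cpow_neg] at h
  rw [show (((k - 1 : ℕ) : ℂ) + 1) = k by push_cast [Nat.cast_sub (show 1 ≤ k by omega)]; ring,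
    Complex.cpow_natCast] at h
  rw [DirichletCharacter.LFunction, DirichletCharacter.LFunction, h, inv_pow]
  change _ = _ * ZMod.LFunction (fun x => φ⁻¹ x) k * _
  ring

/-- The ratio between a lattice sum and the corresponding normalized Eisenstein series. -/
def eisConst (k : ℕ) (φ : DirichletCharacter ℂ M) : ℂ :=
  2 * ((-2 * Real.pi * I) ^ k / (k - 1).factorial) * gaussSum φ⁻¹ ZMod.stdAddChar / (M : ℂ) ^ k

theorem eisConst_ne_zero (k : ℕ) {φ : DirichletCharacter ℂ M} (hφ : φ.IsPrimitive) :
    eisConst k φ ≠ 0 := by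
  have h1 := gaussSum_ne_zero (isPrimitive_inv hφ)
  have h2 : (M : ℂ) ≠ 0 := NeZero.ne _
  have h3 : ((k - 1).factorial : ℂ) ≠ 0 := Nat.cast_ne_zero.mpr (Nat.factorial_ne_zero _)
  have h4 : (-2 * Real.pi * I : ℂ) ≠ 0 := by simp [Real.pi_ne_zero]
  exact div_ne_zero (mul_ne_zero (mul_ne_zero two_ne_zero (div_ne_zero (pow_ne_zero _ h4) h3)) h1)
    (pow_ne_zero _ h2)

/-- This is the functional equation with the two Gauss sums multiplied out. No parity is needed, as
the last factor vanishes for the wrong one. -/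
theorem eisConst_mul_LFunction {φ : DirichletCharacter ℂ M} (hφ : φ.IsPrimitive) {k : ℕ}
    (hk : 2 ≤ k) :
    eisConst k φ * φ.LFunction (1 - k) = 2 * φ⁻¹.LFunction k * (1 + (-1) ^ k * φ (-1)) := by
  have h2 : (M : ℂ) ≠ 0 := NeZero.ne _
  have h3 : ((k - 1).factorial : ℂ) ≠ 0 := Nat.cast_ne_zero.mpr (Nat.factorial_ne_zero _)
  have h4 : (Real.pi : ℂ) ≠ 0 := by simp [Real.pi_ne_zero]
  have hg := gaussSum_mul_gaussSum_inv hφ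
  have hφ1 := apply_neg_one_mul_self φ
  have hI : (I ^ k) ^ 2 = (-1) ^ k := by rw [← pow_mul, mul_comm, pow_mul, I_sq]
  have hI0 : (I ^ k : ℂ) ≠ 0 := pow_ne_zero _ I_ne_zero
  have hM : (M : ℂ) ^ k = M * (M : ℂ) ^ (k - 1) := by
    rw [← pow_succ', Nat.sub_add_cancel (by omega)]
  have hs : ((-1 : ℂ) ^ k) ^ 2 = 1 := by rw [← pow_mul, mul_comm, pow_mul]; simp
  rw [LFunction_one_sub_natCast hφ hk, eisConst, hM,
    show (-2 * Real.pi * I : ℂ) = (-1) * (2 * Real.pi) * I by ring, mul_pow, mul_pow, inv_pow]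
  have h5 : ((2 * Real.pi : ℂ)) ^ k ≠ 0 := pow_ne_zero _ (by simp [Real.pi_ne_zero])
  have h6 : (M : ℂ) ^ (k - 1) ≠ 0 := pow_ne_zero _ h2
  field_simp
  rw [hI]
  linear_combination ((-1) ^ k * DirichletCharacter.LFunction φ⁻¹ k * ((-1) ^ k * φ (-1) + 1)) * hg
    + (M * DirichletCharacter.LFunction φ⁻¹ k) * (((-1) ^ k) ^ 2 * hφ1 + hs)

end GaussSum

/-! ### Lipschitz' formula with a character -/

theorem tsum_residue_classes {M : ℕ} [NeZero M] (φ : ZMod M → ℂ) {f : ℤ → ℂ} (hf : Summable f) :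
    ∑' n : ℤ, φ n * f n = ∑ a : ZMod M, φ a * ∑' m : ℤ, f (a.val + M * m) := by
  -- For a successor modulus, `ZMod` unfolds to the type `Fin` used by `Int.divModEquiv`.
  obtain ⟨M, rfl⟩ := Nat.exists_eq_succ_of_ne_zero (NeZero.ne M)
  obtain ⟨C, hC⟩ := (Set.finite_range fun a => ‖φ a‖).bddAbove
  have hs : Summable fun n : ℤ => φ n * f n :=
    Summable.of_norm_bounded (hf.norm.mul_left C) fun n => by
      rw [norm_mul]
      exact mul_le_mul_of_nonneg_right (hC ⟨_, rfl⟩) (norm_nonneg _)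
  have hs' := (Int.divModEquiv (M + 1)).symm.summable_iff.mpr hs
  rw [← (Int.divModEquiv (M + 1)).symm.tsum_eq, ← (Equiv.prodComm _ _).tsum_eq,
    Summable.tsum_prod (by exact (Equiv.prodComm _ _).summable_iff.mpr hs'), tsum_fintype]
  refine sum_congr rfl fun a _ => ?_
  rw [← tsum_mul_left]
  refine tsum_congr fun m => ?_
  simp only [Equiv.prodComm_apply, Prod.swap_prod_mk, Int.divModEquiv_symm_apply]
  congr 2
  · push_cast
    simp only [ZMod.natCast_self', mul_zero, zero_add]
    exact Fin.cast_val_eq_self a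
  · change m * ((M + 1 : ℕ) : ℤ) + ((a : ℕ) : ℤ) = ((a : ℕ) : ℤ) + ((M + 1 : ℕ) : ℤ) * m
    ring

/-- Lipschitz' formula for a primitive character. -/
theorem tsum_inv_char_mul {M : ℕ} [NeZero M] {φ : DirichletCharacter ℂ M} (hφ : φ.IsPrimitive)
    {k : ℕ} (hk : 2 ≤ k) (w : ℍ) :
    2 * ∑' n : ℤ, φ⁻¹ (n : ZMod M) * ((M : ℂ) * w + n) ^ (-(k : ℤ)) =
      eisConst k φ * ∑' r : ℕ, φ (r : ZMod M) * (r : ℂ) ^ (k - 1) * q w ^ r := by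
  have hM : (M : ℂ) ≠ 0 := NeZero.ne _
  obtain ⟨k, rfl⟩ := Nat.exists_eq_add_of_le' (show 1 ≤ k by omega)
  have hsum : Summable fun n : ℤ => ((M : ℂ) * w + n) ^ (-((k + 1 : ℕ) : ℤ)) := by
    have := EisensteinSeries.linear_right_summable w M (k := ((k + 1 : ℕ) : ℤ)) (by omega)
    simpa only [zpow_neg, Int.cast_natCast] using this
  -- For $n=a+Mm$ one has $Mw+n=M(p_a+m)$ with $p_a=w+a/M$, so the classical Lipschitz formula
  -- applies at $p_a$.
  let p (a : ZMod M) : ℍ := ⟨(w : ℂ) + a.val / M, by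
    rw [Complex.add_im, Complex.div_natCast_im, Complex.natCast_im, zero_div, add_zero]
    exact w.im_pos⟩
  have hq (a : ZMod M) (r : ℕ) :
      cexp (2 * Real.pi * I * p a) ^ r = ZMod.stdAddChar (a * (r : ZMod M)) * q w ^ r := by
    have h1 : a * (r : ZMod M) = ((a.val * r : ℤ) : ZMod M) := by simp
    rw [h1, ZMod.stdAddChar_coe, q, ← Complex.exp_nat_mul, ← Complex.exp_nat_mul, ← Complex.exp_add]
    congr 1
    push_cast
    simp only [p]
    ring
  have hinner (a : ZMod M) :
      ∑' m : ℤ, ((M : ℂ) * w + ((a.val + M * m : ℤ) : ℂ)) ^ (-((k + 1 : ℕ) : ℤ)) =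
      ((M : ℂ) ^ (k + 1))⁻¹ * (((-2 * Real.pi * I) ^ (k + 1) / k.factorial) *
        ∑' r : ℕ, (r : ℂ) ^ k * (ZMod.stdAddChar (a * (r : ZMod M)) * q w ^ r)) := by
    simp_rw [← hq a]
    rw [← EisensteinSeries.qExpansion_identity (by omega) (p a), ← tsum_mul_left]
    refine tsum_congr fun m => ?_
    rw [zpow_neg, zpow_natCast, one_div, ← mul_inv, ← mul_pow]
    congr 2
    push_cast
    simp only [p]
    field_simp
    ring
  have hs (a : ZMod M) : Summable fun r : ℕ =>
      φ⁻¹ a * ((r : ℂ) ^ k * (ZMod.stdAddChar (a * (r : ZMod M)) * q w ^ r)) := by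
    refine Summable.mul_left _ ?_
    simp_rw [← hq a]
    simpa using summable_pow_mul_cexp k 1 (p a)
  -- The inner sum over $a$ is $\varphi(r)g(\bar\varphi)$ for every $r$, coprime to $M$ or not, by
  -- primitivity.
  have hswap : ∑ a : ZMod M, φ⁻¹ a *
      ∑' r : ℕ, (r : ℂ) ^ k * (ZMod.stdAddChar (a * (r : ZMod M)) * q w ^ r) =
      gaussSum φ⁻¹ ZMod.stdAddChar * ∑' r : ℕ, φ (r : ZMod M) * (r : ℂ) ^ k * q w ^ r := by
    simp_rw [← tsum_mul_left]
    rw [← Summable.tsum_finsetSum fun a _ => hs a]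
    refine tsum_congr fun r => ?_
    have := sum_inv_mul_stdAddChar hφ (r : ZMod M)
    calc _ = (∑ a : ZMod M, φ⁻¹ a * ZMod.stdAddChar (a * (r : ZMod M))) *
          ((r : ℂ) ^ k * q w ^ r) := by
          rw [sum_mul]; exact sum_congr rfl fun a _ => by ring
      _ = _ := by rw [this]; ring
  rw [tsum_residue_classes (fun a => φ⁻¹ a) hsum]
  simp_rw [hinner]
  rw [Nat.add_sub_cancel, eisConst, Nat.add_sub_cancel]
  calc _ = 2 * (((M : ℂ) ^ (k + 1))⁻¹ * ((-2 * Real.pi * I) ^ (k + 1) / k.factorial)) *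
        ∑ a : ZMod M, φ⁻¹ a *
          ∑' r : ℕ, (r : ℂ) ^ k * (ZMod.stdAddChar (a * (r : ZMod M)) * q w ^ r) := by
        rw [mul_sum, mul_sum]
        exact sum_congr rfl fun a _ => by ring
    _ = _ := by rw [hswap]; ring

end TraceEis

end

noncomputable section

namespace TraceEis

open UpperHalfPlane hiding I
open Complex Filter Finset

/-! ### Lattice sums and their Fourier expansions -/

theorem tsum_pnat_prod_eq_tsum_divisorsAntidiagonal {G : ℕ → ℕ → ℂ}
    (hG : Summable fun x : ℕ+ × ℕ+ => G x.1 x.2) :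
    ∑' x : ℕ+ × ℕ+, G x.1 x.2 = ∑' n : ℕ+, ∑ d ∈ (n : ℕ).divisorsAntidiagonal, G d.1 d.2 := by
  have hs := sigmaAntidiagonalEquivProd.summable_iff.mpr hG
  refine (sigmaAntidiagonalEquivProd.tsum_eq (fun x : ℕ+ × ℕ+ => G x.1 x.2)).symm.trans
    (hs.tsum_sigma.trans ?_)
  refine tsum_congr fun n => ?_
  rw [tsum_fintype, ← Finset.sum_coe_sort (n : ℕ).divisorsAntidiagonal]
  rfl

section LatticeSum

variable {M N : ℕ} [NeZero M]

/-- The point `m z` of the upper half plane. -/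
def scale (m : ℕ) [NeZero m] (z : ℍ) : ℍ :=
  ⟨(m : ℂ) * z, by
    rw [Complex.mul_im, Complex.natCast_im, zero_mul, add_zero, Complex.natCast_re]
    exact mul_pos (Nat.cast_pos.mpr (NeZero.pos m)) z.im_pos⟩

theorem q_scale (m : ℕ) [NeZero m] (z : ℍ) : q (scale m z) = q z ^ m := by
  rw [q, q, ← Complex.exp_nat_mul]
  congr 1
  simp only [scale]
  ring

/-- The sum `∑ ψ(c) φ̄(d) (cMz + d)^{-k}` over all integers `c`, `d`. -/
def latticeSum (k : ℕ) (φ : DirichletCharacter ℂ M) (ψ : DirichletCharacter ℂ N) (z : ℍ) : ℂ :=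
  ∑' v : ℤ × ℤ, ψ v.1 * φ⁻¹ v.2 * ((v.1 : ℂ) * M * z + v.2) ^ (-(k : ℤ))

theorem summable_latticeSum {k : ℕ} (hk : 3 ≤ k) (φ : DirichletCharacter ℂ M)
    (ψ : DirichletCharacter ℂ N) (z : ℍ) :
    Summable fun v : ℤ × ℤ => ψ v.1 * φ⁻¹ v.2 * ((v.1 : ℂ) * M * z + v.2) ^ (-(k : ℤ)) := by
  refine Summable.of_norm_bounded (summable_prod_eisSummand hk (scale M z)).norm fun v => ?_
  rw [norm_mul, norm_mul]
  have h : ((v.1 : ℂ) * M * z + v.2) ^ (-(k : ℤ)) =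
      EisensteinSeries.eisSummand k ![v.1, v.2] (scale M z) := by
    simp [EisensteinSeries.eisSummand, scale, mul_assoc]
  rw [h]
  exact mul_le_of_le_one_left (norm_nonneg _) (mul_le_one₀ (ψ.norm_le_one _) (norm_nonneg _)
    (φ⁻¹.norm_le_one _))

theorem tsum_sigmaTwo_pnat [NeZero N] {k : ℕ} (φ : DirichletCharacter ℂ M)
    (ψ : DirichletCharacter ℂ N) (z : ℍ) :
    ∑' c : ℕ+, ∑' r : ℕ+, ψ (c : ℕ) * (φ (r : ℕ) * (r : ℂ) ^ (k - 1) * q z ^ (c * r : ℕ)) =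
      ∑' n : ℕ+, sigmaTwo k φ ψ n * q z ^ (n : ℕ) := by
  have hs : Summable fun x : ℕ+ × ℕ+ =>
      φ (x.1 : ℕ) * ψ (x.2 : ℕ) * (x.1 : ℂ) ^ (k - 1) * q z ^ (x.1 * x.2 : ℕ) := by
    have := (summable_prod_mul_pow (k - 1) (norm_q_lt_one z)).prod_symm
    refine Summable.of_norm_bounded this.norm fun x => ?_
    rw [norm_mul, norm_mul, norm_mul, norm_mul, mul_comm (x.1 : ℕ)]
    refine mul_le_mul_of_nonneg_right ?_ (norm_nonneg _)
    exact mul_le_of_le_one_left (norm_nonneg _) (mul_le_one₀ (φ.norm_le_one _) (norm_nonneg _)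
      (ψ.norm_le_one _))
  have h1 : ∑' c : ℕ+, ∑' r : ℕ+, ψ (c : ℕ) *
        (φ (r : ℕ) * (r : ℂ) ^ (k - 1) * q z ^ (c * r : ℕ)) = ∑' x : ℕ+ × ℕ+,
      φ (x.1 : ℕ) * ψ (x.2 : ℕ) * (x.1 : ℂ) ^ (k - 1) * q z ^ (x.1 * x.2 : ℕ) := by
    rw [← (Equiv.prodComm _ _).tsum_eq, Summable.tsum_prod
      (by exact (Equiv.prodComm _ _).summable_iff.mpr hs)]
    refine tsum_congr fun c => tsum_congr fun r => ?_
    simp only [Equiv.prodComm_apply, Prod.swap_prod_mk, mul_comm (r : ℕ)]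
    ring
  rw [h1, tsum_pnat_prod_eq_tsum_divisorsAntidiagonal
    (G := fun r c => φ r * ψ c * (r : ℂ) ^ (k - 1) * q z ^ (r * c)) hs]
  refine tsum_congr fun n => ?_
  rw [sigmaTwo, if_neg n.ne_zero, sum_mul]
  refine sum_congr rfl fun d hd => ?_
  rw [(Nat.mem_divisorsAntidiagonal.mp hd).1]

/-- By parity the functional equation leaves a factor $1+\psi(-1)$. For even $\psi$ one has
$L(0,\psi)=-\psi(0)/2$; for odd $\psi$ both sides vanish, since then $N\ne1$ and $\psi(0)=0$. -/
theorem sigmaTwo_zero_eq [NeZero N] {k : ℕ} (hk : 2 ≤ k) {φ : DirichletCharacter ℂ M}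
    (hφ : φ.IsPrimitive)
    {ψ : DirichletCharacter ℂ N} (hpar : φ (-1) * ψ (-1) = (-1) ^ k) :
    eisConst k φ * sigmaTwo k φ ψ 0 = 2 * ψ 0 * φ⁻¹.LFunction k := by
  have h1 := eisConst_mul_LFunction hφ hk
  rw [sigmaTwo, if_pos rfl, mul_neg, ← mul_assoc, h1]
  have hψ1 := apply_neg_one_mul_self ψ
  have hs : ((-1 : ℂ) ^ k) * (-1) ^ k = 1 := by rw [← mul_pow]; simp
  have hφψ : (-1) ^ k * φ (-1) = ψ (-1) := by
    linear_combination (-1) ^ k * ψ (-1) * hpar - (-1) ^ k * φ (-1) * hψ1 + ψ (-1) * hs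
  rw [hφψ]
  rcases ψ.even_or_odd with h | h
  · have : ψ.LFunction 0 = -ψ 0 / 2 := ZMod.LFunction_apply_zero_of_even h.to_fun
    rw [this, h]
    ring
  · have hN : N ≠ 1 := by
      rintro rfl
      have : ψ (-1) = 1 := by rw [Subsingleton.elim (-1 : ZMod 1) 1, map_one]
      rw [h] at this
      norm_num at this
    have : Nontrivial (ZMod N) := ZMod.nontrivial_iff.mpr hN
    rw [h, MulChar.map_zero]
    ring

theorem two_mul_LFunction_eq {k : ℕ} (hk : 2 ≤ k) {φ : DirichletCharacter ℂ M}
    (hφ : φ (-1) = (-1) ^ k) :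
    ∑' n : ℤ, φ n * (n : ℂ) ^ (-(k : ℤ)) = 2 * φ.LFunction k := by
  have hs : Summable fun n : ℤ => φ n * (n : ℂ) ^ (-(k : ℤ)) := by
    have := EisensteinSeries.linear_right_summable 0 0 (k := k) (by omega)
    refine Summable.of_norm_bounded (g := fun n : ℤ => ‖((n : ℂ) ^ k)⁻¹‖)
      (by simpa using this.norm) fun n => ?_
    rw [norm_mul, zpow_neg, zpow_natCast]
    exact mul_le_of_le_one_left (norm_nonneg _) (φ.norm_le_one n)
  have hev : Function.Even fun n : ℤ => φ n * (n : ℂ) ^ (-(k : ℤ)) := by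
    intro n
    have : ((-1 : ℂ) ^ k) * (-1) ^ k = 1 := by rw [← mul_pow]; simp
    simp only [Int.cast_neg]
    rw [neg_eq_neg_one_mul, map_mul, hφ, zpow_neg, zpow_neg, zpow_natCast, zpow_natCast,
      neg_pow (n : ℂ),
      mul_inv, ← inv_pow, inv_neg_one]
    linear_combination φ n * ((n : ℂ) ^ k)⁻¹ * this
  rw [tsum_int_eq_zero_add_two_mul_tsum_pnat hev hs, DirichletCharacter.LFunction_eq_LSeries _
    (by rw [Complex.natCast_re]; exact_mod_cast hk), LSeries,
    ← tsum_pnat_eq_tsum_of_eq_zero (LSeries.term_zero _ _), Int.cast_zero, Int.cast_zero,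
    zero_zpow _ (by omega), mul_zero, zero_add, nsmul_eq_mul, Nat.cast_ofNat]
  congr 1
  refine tsum_congr fun n => ?_
  rw [LSeries.term_of_ne_zero n.ne_zero, zpow_neg, zpow_natCast, Complex.cpow_natCast,
    div_eq_mul_inv]
  simp

/-- Parity makes the rows $c$ and $-c$ equal. The row $c=0$ is the constant term, and each row $c>0$
is Lipschitz' formula at $cz$; collecting $cr=n$ gives the divisor sum. -/
theorem latticeSum_eq [NeZero N] {k : ℕ} (hk : 3 ≤ k) {φ : DirichletCharacter ℂ M}
    (hφ : φ.IsPrimitive)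
    {ψ : DirichletCharacter ℂ N} (hpar : φ (-1) * ψ (-1) = (-1) ^ k) (z : ℍ) :
    latticeSum k φ ψ z = eisConst k φ * GTwo k φ ψ z := by
  have hs := summable_latticeSum hk φ ψ z
  have hev : Function.Even fun c : ℤ =>
      ∑' d : ℤ, ψ c * φ⁻¹ d * ((c : ℂ) * M * z + d) ^ (-(k : ℤ)) := by
    intro c
    simp only
    rw [← tsum_comp_neg]
    refine tsum_congr fun d => ?_
    have : ((-1 : ℂ) ^ k) * (-1) ^ k = 1 := by rw [← mul_pow]; simp
    rw [Int.cast_neg, Int.cast_neg, Int.cast_neg, Int.cast_neg,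
      show (-(c : ℂ) * M * z + -(d : ℂ)) = -1 * (c * M * z + d) by ring, zpow_neg, zpow_neg,
      zpow_natCast, zpow_natCast, mul_pow, neg_eq_neg_one_mul (c : ZMod N),
      neg_eq_neg_one_mul (d : ZMod M), map_mul, map_mul, inv_apply_neg_one, mul_inv, ← inv_pow,
      inv_neg_one]
    linear_combination ψ c * φ⁻¹ d * ((c * M * z + d : ℂ) ^ k)⁻¹ * ((-1) ^ k * hpar + this)
  have h0 : ∑' d : ℤ, ψ ((0 : ℤ) : ZMod N) * φ⁻¹ d * (((0 : ℤ) : ℂ) * M * z + d) ^ (-(k : ℤ)) =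
      eisConst k φ * sigmaTwo k φ ψ 0 := by
    rw [sigmaTwo_zero_eq (by omega) hφ hpar]
    simp only [Int.cast_zero, zero_mul, zero_add, mul_assoc, tsum_mul_left]
    rcases eq_or_ne N 1 with rfl | hN
    · have hψ : ∀ x : ZMod 1, ψ x = 1 := fun x => by rw [Subsingleton.elim x 1, map_one]
      rw [hψ, two_mul_LFunction_eq (by omega) (by rw [inv_apply_neg_one, ← hpar, hψ, mul_one])]
      ring
    · have : Nontrivial (ZMod N) := ZMod.nontrivial_iff.mpr hN
      rw [MulChar.map_zero]
      ring
  have hpos (c : ℕ+) : 2 * ∑' d : ℤ, ψ ((c : ℤ) : ZMod N) * φ⁻¹ d *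
      (((c : ℤ) : ℂ) * M * z + d) ^ (-(k : ℤ)) = eisConst k φ *
      ∑' r : ℕ+, ψ (c : ℕ) * (φ (r : ℕ) * (r : ℂ) ^ (k - 1) * q z ^ (c * r : ℕ)) := by
    have h := tsum_inv_char_mul hφ (show 2 ≤ k by omega) (scale c z)
    rw [← tsum_pnat_eq_tsum_of_eq_zero (by simp [show k - 1 ≠ 0 by omega]), q_scale] at h
    simp_rw [mul_assoc, tsum_mul_left, pow_mul]
    simp only [mul_assoc] at h
    rw [mul_left_comm, mul_left_comm (eisConst k φ), ← h]
    simp only [scale, Int.cast_natCast, mul_left_comm (M : ℂ)]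
  rw [latticeSum, hs.tsum_prod, tsum_int_eq_zero_add_two_mul_tsum_pnat hev hs.prod]
  rw [h0, nsmul_eq_mul, Nat.cast_ofNat, ← tsum_mul_left, tsum_congr hpos, tsum_mul_left,
    tsum_sigmaTwo_pnat, ← mul_add]
  congr 1
  rw [GTwo, ← tsum_zero_pnat_eq_tsum_nat ((polyGrowth_sigmaTwo (by omega) φ ψ).hasSum z).summable]
  simp

end LatticeSum

end TraceEis

end

noncomputable section

namespace TraceEis

open UpperHalfPlane hiding I
open Complex Filter Finset EisensteinSeries

/-! ### Characters of composite level -/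

section Factor

variable {m n D : ℕ} {χ : DirichletCharacter ℂ D} {χ₁ : DirichletCharacter ℂ m}
  {χ₂ : DirichletCharacter ℂ n}

/-- `χ(a) = χ₁(a) χ₂(a)` for all integers `a`. -/
def IsFactorization (χ : DirichletCharacter ℂ D) (χ₁ : DirichletCharacter ℂ m)
    (χ₂ : DirichletCharacter ℂ n) : Prop :=
  ∀ a : ℤ, χ (a : ZMod D) = χ₁ (a : ZMod m) * χ₂ (a : ZMod n)

theorem IsFactorization.inv (h : IsFactorization χ χ₁ χ₂) : IsFactorization χ⁻¹ χ₁⁻¹ χ₂⁻¹ :=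
  fun a => by simp only [MulChar.inv_apply_eq_inv', h a, mul_inv]

theorem isFactorization_fst_snd [NeZero D] (hD : Squarefree D) (χ : DirichletCharacter ℂ D)
    (p : Factorization D) : IsFactorization χ (fst hD χ p) (snd hD χ p) := by
  intro a
  by_cases ha : IsUnit (a : ZMod D)
  · obtain ⟨u, hu⟩ := ha
    conv_lhs => rw [← fst_mul_snd hD χ p]
    rw [MulChar.mul_apply, ← hu, DirichletCharacter.changeLevel_eq_cast_of_dvd,
      DirichletCharacter.changeLevel_eq_cast_of_dvd, hu,
      ZMod.cast_intCast (Dvd.intro _ p.mul_eq), ZMod.cast_intCast (Dvd.intro _ p.mul_eq')]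
  · rw [MulChar.map_nonunit _ ha]
    have : ¬ IsUnit (a : ZMod p.D₁) ∨ ¬ IsUnit (a : ZMod p.D₂) := by
      by_contra! hc
      rw [ZMod.coe_int_isUnit_iff_isCoprime, ZMod.coe_int_isUnit_iff_isCoprime] at hc
      refine ha ((ZMod.coe_int_isUnit_iff_isCoprime _ _).mpr ?_)
      rw [← p.mul_eq, Nat.cast_mul]
      exact hc.1.mul_left hc.2
    rcases this with h | h
    · rw [MulChar.map_nonunit _ h, zero_mul]
    · rw [MulChar.map_nonunit _ h, mul_zero]

theorem bijective_crt [NeZero m] [NeZero n] (hc : Nat.Coprime m n) :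
    Function.Bijective fun x : ZMod m × ZMod n =>
      (((x.1.val * n + x.2.val * m : ℕ) : ℤ) : ZMod (m * n)) := by
  rw [Fintype.bijective_iff_injective_and_card]
  refine ⟨fun x y h => ?_, by simp [ZMod.card]⟩
  have hn : IsUnit ((n : ℕ) : ZMod m) := (ZMod.isUnit_iff_coprime n m).mpr hc.symm
  have hm : IsUnit ((m : ℕ) : ZMod n) := (ZMod.isUnit_iff_coprime m n).mpr hc
  have h1 := congrArg (ZMod.castHom (Dvd.intro _ rfl : m ∣ m * n) (ZMod m)) h
  have h2 := congrArg (ZMod.castHom (Dvd.intro_left _ rfl : n ∣ m * n) (ZMod n)) h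
  simp only [map_intCast] at h1 h2
  push_cast at h1 h2
  simp only [ZMod.natCast_self, mul_zero, add_zero, zero_add, ZMod.natCast_val, ZMod.cast_id',
    id_eq] at h1 h2
  exact Prod.ext (hn.mul_right_cancel h1) (hm.mul_right_cancel h2)

/-- Writing residues modulo $mn$ as $an+bm$ splits the additive character exactly; the cost is the
twist $\chi_1(n)\chi_2(m)$. -/
theorem gaussSum_factorization [NeZero m] [NeZero n] [NeZero D] (hmn : m * n = D)
    (hc : Nat.Coprime m n) (h : IsFactorization χ χ₁ χ₂) :
    gaussSum χ ZMod.stdAddChar = χ₁ n * χ₂ m * gaussSum χ₁ ZMod.stdAddChar *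
      gaussSum χ₂ ZMod.stdAddChar := by
  subst hmn
  have hm0 : (m : ℂ) ≠ 0 := NeZero.ne _
  have hn0 : (n : ℂ) ≠ 0 := NeZero.ne _
  rw [gaussSum, ← (bijective_crt hc).sum_comp, mul_assoc, gaussSum, gaussSum, sum_mul_sum,
    ← univ_product_univ, sum_product, mul_sum]
  refine sum_congr rfl fun a _ => ?_
  rw [mul_sum]
  refine sum_congr rfl fun b _ => ?_
  rw [h, ZMod.stdAddChar_coe]
  have h1 : ((((a.val * n + b.val * m : ℕ) : ℤ)) : ZMod m) = a * n := by simp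
  have h2 : ((((a.val * n + b.val * m : ℕ) : ℤ)) : ZMod n) = b * m := by simp
  have h3 : cexp (2 * Real.pi * I * (((a.val * n + b.val * m : ℕ) : ℤ) : ℂ) / (m * n : ℕ)) =
      ZMod.stdAddChar a * ZMod.stdAddChar b := by
    have ha : a = ((a.val : ℤ) : ZMod m) := by simp
    have hb : b = ((b.val : ℤ) : ZMod n) := by simp
    conv_rhs => rw [ha, hb, ZMod.stdAddChar_coe, ZMod.stdAddChar_coe, ← Complex.exp_add]
    congr 1
    push_cast
    field_simp
  rw [h1, h2, h3, map_mul, map_mul]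
  ring

end Factor

/-! ### Slash action on lattice sums -/

/-- The sum `∑ h(c, d) (cz + d)^{-k}` over all integers `c`, `d`. -/
def weightedSum (k : ℕ) (h : ℤ → ℤ → ℂ) (z : ℍ) : ℂ :=
  ∑' v : Fin 2 → ℤ, h (v 0) (v 1) * eisSummand k v z

theorem det_SL_eq_one (γ : SL(2, ℤ)) : γ 0 0 * γ 1 1 - γ 0 1 * γ 1 0 = 1 := by
  rw [← Matrix.det_fin_two]; exact γ.2

/-- The sum is reindexed by $v\mapsto v\gamma$; the arguments of the new weight are the entries of
$(c,d)\gamma^{-1}$. -/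
theorem weightedSum_slash (k : ℕ) (h : ℤ → ℤ → ℂ) (γ : SL(2, ℤ)) :
    weightedSum k h ∣[(k : ℤ)] γ =
      weightedSum k fun c d => h (c * γ 1 1 - d * γ 1 0) (d * γ 0 0 - c * γ 0 1) := by
  ext z
  have hd := zpow_ne_zero (k : ℤ) (denom_ne_zero γ z)
  have hdet := det_SL_eq_one γ
  let e : (Fin 2 → ℤ) ≃ (Fin 2 → ℤ) :=
    { toFun := fun v => Matrix.vecMul v γ.1
      invFun := fun v => Matrix.vecMul v (γ⁻¹).1
      left_inv := fun v => by
        simp only [Matrix.vecMul_vecMul, ← Matrix.SpecialLinearGroup.coe_mul, mul_inv_cancel,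
          Matrix.SpecialLinearGroup.coe_one, Matrix.vecMul_one]
      right_inv := fun v => by
        simp only [Matrix.vecMul_vecMul, ← Matrix.SpecialLinearGroup.coe_mul, inv_mul_cancel,
          Matrix.SpecialLinearGroup.coe_one, Matrix.vecMul_one] }
  have he (v : Fin 2 → ℤ) (i : Fin 2) : e v i = v 0 * γ 0 i + v 1 * γ 1 i := by
    change Matrix.vecMul v γ.1 i = _
    rw [Matrix.vecMul, Matrix.vec2_dotProduct]
  rw [ModularForm.SL_slash_apply, weightedSum, weightedSum, ← tsum_mul_right]
  refine Eq.trans ?_ (e.tsum_eq _)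
  refine tsum_congr fun v => ?_
  have h1 : e v 0 * γ 1 1 - e v 1 * γ 1 0 = v 0 := by
    rw [he, he]; linear_combination v 0 * hdet
  have h2 : e v 1 * γ 0 0 - e v 0 * γ 0 1 = v 1 := by
    rw [he, he]; linear_combination v 1 * hdet
  have h3 : eisSummand k (e v) z = eisSummand k (Matrix.vecMul v γ.1) z := rfl
  simp only [h1, h2, h3]
  rw [eisSummand_SL2_apply, zpow_neg]
  field_simp

/-- The weight function whose lattice sum is proportional to `G_{k,χ}`. -/
def charWeight {D : ℕ} (χ : DirichletCharacter ℂ D) (c d : ℤ) : ℂ :=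
  if (D : ℤ) ∣ c then χ⁻¹ d else 0

theorem weightedSum_eq_tsum {k : ℕ} {h : ℤ → ℤ → ℂ} {ι : ℤ × ℤ → ℤ × ℤ}
    (hι : Function.Injective ι) (hs : ∀ c d, h c d ≠ 0 → ∃ x, ι x = (c, d)) (z : ℍ) :
    weightedSum k h z =
      ∑' x : ℤ × ℤ, h (ι x).1 (ι x).2 * (((ι x).1 : ℂ) * z + (ι x).2) ^ (-(k : ℤ)) := by
  rw [weightedSum, ← (finTwoArrowEquiv ℤ).symm.tsum_eq, ← hι.tsum_eq]
  · rfl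
  · rintro ⟨c, d⟩ hv
    exact hs c d (left_ne_zero_of_mul hv)

theorem weightedSum_charWeight {D : ℕ} [NeZero D] (k : ℕ) (χ : DirichletCharacter ℂ D) (z : ℍ) :
    weightedSum k (charWeight χ) z = latticeSum k χ (1 : DirichletCharacter ℂ 1) z := by
  have hD : (D : ℤ) ≠ 0 := by exact_mod_cast NeZero.ne D
  rw [weightedSum_eq_tsum (ι := fun x => (D * x.1, x.2))]
  · refine tsum_congr fun x => ?_
    have h1 : ((x.1 : ℤ) : ZMod 1) = 1 := Subsingleton.elim _ _
    simp [charWeight, h1, mul_comm]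
  · intro x y hxy
    simp only [Prod.mk.injEq, mul_eq_mul_left_iff, hD, or_false] at hxy
    exact Prod.ext hxy.1 hxy.2
  · intro c d hv
    have : (D : ℤ) ∣ c := by
      by_contra hc
      exact hv (if_neg hc)
    obtain ⟨c, rfl⟩ := this
    exact ⟨(c, d), rfl⟩

/-! ### Eisenstein series with one character and their transformation laws -/

theorem sigmaOne_eq_sigmaTwo {D : ℕ} [NeZero D] (k : ℕ) (χ : DirichletCharacter ℂ D) :
    sigmaOne k χ = sigmaTwo k χ (1 : DirichletCharacter ℂ 1) := by
  ext n
  have h1 : ∀ x : ZMod 1, (1 : DirichletCharacter ℂ 1) x = 1 := fun x => by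
    rw [Subsingleton.elim x 1, map_one]
  rw [sigmaOne, sigmaTwo]
  split_ifs
  · rw [DirichletCharacter.LFunction_modOne_eq, riemannZeta_zero]
    ring
  · simp only [h1, mul_one]
    rw [Nat.sum_divisorsAntidiagonal (f := fun a _ => χ (a : ZMod D) * (a : ℂ) ^ (k - 1))]

theorem GOne_eq_GTwo {D : ℕ} [NeZero D] (k : ℕ) (χ : DirichletCharacter ℂ D) :
    GOne k χ = GTwo k χ (1 : DirichletCharacter ℂ 1) := by
  ext z
  rw [GOne, GTwo, sigmaOne_eq_sigmaTwo]

theorem weightedSum_charWeight_eq {D : ℕ} [NeZero D] {k : ℕ} (hk : 3 ≤ k)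
    {χ : DirichletCharacter ℂ D} (hχ : χ.IsPrimitive) (hpar : χ (-1) = (-1) ^ k) :
    weightedSum k (charWeight χ) = eisConst k χ • GOne k χ := by
  ext z
  rw [weightedSum_charWeight, latticeSum_eq hk hχ, GOne_eq_GTwo, Pi.smul_apply, smul_eq_mul]
  rw [hpar, Subsingleton.elim (-1 : ZMod 1) 1, map_one, mul_one]

/-- The condition $D\mid c$ is preserved, and on its support $d$ is multiplied modulo $D$ by
$\gamma_{00}\equiv\gamma_{11}^{-1}$, so the weight is scaled by $\chi(\gamma_{11})$. -/
theorem GOne_slash_Gamma0 {D : ℕ} [NeZero D] {k : ℕ} (hk : 3 ≤ k)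
    {χ : DirichletCharacter ℂ D} (hχ : χ.IsPrimitive) (hpar : χ (-1) = (-1) ^ k) {γ : SL(2, ℤ)}
    (hγ : γ ∈ CongruenceSubgroup.Gamma0 D) :
    GOne k χ ∣[(k : ℤ)] γ = χ ((γ 1 1 : ℤ) : ZMod D) • GOne k χ := by
  have hc : (D : ℤ) ∣ γ 1 0 :=
    (ZMod.intCast_zmod_eq_zero_iff_dvd _ _).mp (CongruenceSubgroup.Gamma0_mem.mp hγ)
  have hdet := det_SL_eq_one γ
  have had : ((γ 0 0 : ℤ) : ZMod D) * ((γ 1 1 : ℤ) : ZMod D) = 1 := by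
    have h0 : ((γ 1 0 : ℤ) : ZMod D) = 0 := CongruenceSubgroup.Gamma0_mem.mp hγ
    have := congrArg (Int.cast (R := ZMod D)) hdet
    push_cast at this
    simpa [h0] using this
  have hcop : IsCoprime (D : ℤ) (γ 1 1) := by
    obtain ⟨c, hc⟩ := hc
    exact ⟨-(γ 0 1 * c), γ 0 0, by linear_combination hdet + γ 0 1 * hc⟩
  have hw : (fun c d => charWeight χ (c * γ 1 1 - d * γ 1 0) (d * γ 0 0 - c * γ 0 1)) =
      fun c d => χ ((γ 1 1 : ℤ) : ZMod D) * charWeight χ c d := by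
    ext c d
    have hiff : (D : ℤ) ∣ c * γ 1 1 - d * γ 1 0 ↔ (D : ℤ) ∣ c := by
      rw [dvd_sub_left (hc.mul_left _)]
      exact ⟨fun h => hcop.dvd_of_dvd_mul_right h, fun h => h.mul_right _⟩
    simp only [charWeight, hiff]
    split_ifs with h
    · have h0 : (c : ZMod D) = 0 := (ZMod.intCast_zmod_eq_zero_iff_dvd _ _).mpr h
      push_cast
      rw [h0, zero_mul, sub_zero, map_mul, mul_comm]
      congr 1
      rw [MulChar.inv_apply_eq_inv', inv_eq_iff_eq_inv]
      exact eq_inv_of_mul_eq_one_left (by rw [← map_mul, had, map_one])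
    · rw [mul_zero]
  have h1 := weightedSum_slash k (charWeight χ) γ
  have h2 : weightedSum k (fun c d => χ ((γ 1 1 : ℤ) : ZMod D) * charWeight χ c d) =
      χ ((γ 1 1 : ℤ) : ZMod D) • weightedSum k (charWeight χ) := by
    ext z
    simp only [weightedSum, Pi.smul_apply, smul_eq_mul, mul_assoc, tsum_mul_left]
  rw [hw, h2, weightedSum_charWeight_eq hk hχ hpar, ModularForm.SL_smul_slash, smul_comm] at h1
  exact smul_right_injective _ (eisConst_ne_zero k hχ) h1

/-- A matrix with lower row `(m, 1 + m t)`. -/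
def cuspMatrix (m t : ℤ) : SL(2, ℤ) := ⟨!![1, t; m, 1 + m * t], by
  rw [Matrix.det_fin_two_of]; ring⟩

/-- The support condition forces $c=mc'$, and since $1+m(y-y_0)\equiv my$ modulo $n$ it becomes
$d=c'my+nd'$. Then $cz+d=n(mc'\frac{z+y}{n}+d')$, while the argument of $\bar\chi$ is $nd'$ modulo
$m$ and $c'$ modulo $n$. The shift by $y_0$ is chosen for this. -/
theorem weightedSum_charWeight_cuspMatrix {m n D : ℕ} [NeZero m] [NeZero n] [NeZero D]
    (hmn : m * n = D) {χ : DirichletCharacter ℂ D} {χ₁ : DirichletCharacter ℂ m}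
    {χ₂ : DirichletCharacter ℂ n} (h : IsFactorization χ χ₁ χ₂) (k y : ℕ) {y₀ : ℤ}
    (hy₀ : (n : ℤ) ∣ m * y₀ - 1) (z : ℍ) :
    weightedSum k (fun c d => charWeight χ (c * (1 + m * (y - y₀)) - d * m)
        (d * 1 - c * (y - y₀))) z =
      χ₁⁻¹ n * ((n : ℂ) ^ k)⁻¹ * latticeSum k χ₁ χ₂⁻¹ (shiftDiv n y z) := by
  have hm : (m : ℤ) ≠ 0 := by exact_mod_cast NeZero.ne m
  have hn : (n : ℤ) ≠ 0 := by exact_mod_cast NeZero.ne n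
  have hnC : (n : ℂ) ≠ 0 := NeZero.ne _
  obtain ⟨u, hu⟩ := hy₀
  have hDmn : (D : ℤ) = m * n := by rw [← hmn]; push_cast; ring
  rw [weightedSum_eq_tsum (ι := fun x => (m * x.1, x.1 * m * y + n * x.2)), latticeSum,
    ← tsum_mul_left]
  · refine tsum_congr fun x => ?_
    simp only
    rw [charWeight, if_pos ⟨-(x.1 * u) - x.2, by
      rw [hDmn]; linear_combination (-(m : ℤ) * x.1) * hu⟩, h.inv, mul_one]
    have h1 : ((x.1 * m * y + n * x.2 - m * x.1 * (y - y₀) : ℤ) : ZMod m) = n * x.2 := by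
      push_cast; simp
    have h2 : ((x.1 * m * y + n * x.2 - m * x.1 * (y - y₀) : ℤ) : ZMod n) = x.1 := by
      rw [show (x.1 * m * y + n * x.2 - m * x.1 * (y - y₀) : ℤ) = x.1 + n * (x.2 + x.1 * u) by
        linear_combination x.1 * hu]
      push_cast; simp
    have h3 : ((x.1 : ℂ) * m * (shiftDiv n y z : ℍ) + x.2) =
        (n : ℂ)⁻¹ * ((m * x.1) * z + (x.1 * m * y + n * x.2)) := by
      simp only [shiftDiv]
      field_simp
      ring
    rw [h1, h2, h3, map_mul, mul_zpow]
    push_cast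
    rw [zpow_neg (n : ℂ)⁻¹, zpow_natCast, inv_pow, inv_inv]
    field_simp
  · intro x x' hx
    simp only [Prod.mk.injEq, mul_eq_mul_left_iff, hm, or_false] at hx
    obtain ⟨h0, h1⟩ := hx
    rw [h0, add_right_inj, mul_eq_mul_left_iff, or_iff_left hn] at h1
    exact Prod.ext h0 h1
  · intro c d hv
    have hd : (D : ℤ) ∣ c * (1 + m * (y - y₀)) - d * m := by
      by_contra hc
      exact hv (if_neg hc)
    obtain ⟨w, hw⟩ := hd
    rw [hDmn] at hw
    -- Solving $c+cm(y-y_0)-dm=mnw$ for $c$ exhibits it as $m$ times this $c'$.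
    obtain ⟨c', hc'⟩ : ∃ c', c' = n * w - c * (y - y₀) + d := ⟨_, rfl⟩
    have hc : c = m * c' := by linear_combination hw - m * hc'
    refine ⟨(c', -w - u * c'), Prod.ext hc.symm ?_⟩
    change c' * m * y + n * (-w - u * c') = d
    linear_combination hc' + c' * hu - (y - y₀) * hc

/-- In the ratio of `eisConst` for $\chi_1$ and $\chi$ the powers cancel against $n^{-k}$, and
factoring $g(\bar\chi)$ cancels $\bar\chi_1(n)$ and $g(\bar\chi_1)$, leaving only data of $\chi_2$.
-/
theorem GOne_slash_cuspMatrix {m n D : ℕ} [NeZero m] [NeZero n] [NeZero D]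
    (hmn : m * n = D) (hcop : Nat.Coprime m n) {χ : DirichletCharacter ℂ D}
    {χ₁ : DirichletCharacter ℂ m} {χ₂ : DirichletCharacter ℂ n} (h : IsFactorization χ χ₁ χ₂)
    (hχ : χ.IsPrimitive) (hχ₁ : χ₁.IsPrimitive) (hχ₂ : χ₂.IsPrimitive) {k : ℕ} (hk : 3 ≤ k)
    (hpar : χ (-1) = (-1) ^ k) (y : ℕ) {y₀ : ℤ} (hy₀ : (n : ℤ) ∣ m * y₀ - 1) :
    GOne k χ ∣[(k : ℤ)] cuspMatrix m (y - y₀) =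
      (χ₂⁻¹ m * gaussSum χ₂⁻¹ ZMod.stdAddChar)⁻¹ • (GTwo k χ₁ χ₂⁻¹ ∘ shiftDiv n y) := by
  have hχC := eisConst_ne_zero k hχ
  have hg := gaussSum_factorization hmn hcop h.inv
  have hg1 := gaussSum_ne_zero (isPrimitive_inv hχ₁)
  have hg2 := gaussSum_ne_zero (isPrimitive_inv hχ₂)
  have hg0 := gaussSum_ne_zero (isPrimitive_inv hχ)
  rw [hg] at hg0
  have hmC : (m : ℂ) ≠ 0 := NeZero.ne _
  have hnC : (n : ℂ) ≠ 0 := NeZero.ne _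
  have h3 : ((k - 1).factorial : ℂ) ≠ 0 := Nat.cast_ne_zero.mpr (Nat.factorial_ne_zero _)
  have h4 : (-2 * Real.pi * I : ℂ) ^ k ≠ 0 := pow_ne_zero _ (by simp [Real.pi_ne_zero])
  have h1 := weightedSum_slash k (charWeight χ) (cuspMatrix m (y - y₀))
  rw [weightedSum_charWeight_eq hk hχ hpar, ModularForm.SL_smul_slash] at h1
  ext z
  have h2 := (congrFun h1 z).trans (show _ = weightedSum k (fun c d => charWeight χ
    (c * (1 + m * (y - y₀)) - d * m) (d * 1 - c * (y - y₀))) z from rfl)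
  rw [weightedSum_charWeight_cuspMatrix hmn h k y hy₀, latticeSum_eq hk hχ₁, Pi.smul_apply,
    smul_eq_mul] at h2
  · refine mul_left_cancel₀ hχC (h2.trans ?_)
    -- Both character values are factors of the nonzero Gauss sum of $\bar\chi$.
    have hχ₁n : χ₁⁻¹ (n : ZMod m) ≠ 0 := by
      intro h0; simp [h0] at hg0
    have hχ₂m : χ₂⁻¹ (m : ZMod n) ≠ 0 := by
      intro h0; simp [h0] at hg0
    have hDC : (D : ℂ) = m * n := by rw [← hmn]; push_cast; ring
    simp only [eisConst, hg, Pi.smul_apply, smul_eq_mul, Function.comp_apply, hDC, mul_pow]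
    field_simp
  · rw [inv_apply_neg_one, ← hpar]
    have := h (-1)
    push_cast at this
    exact this.symm

end TraceEis

end

noncomputable section

namespace TraceEis

open Complex Filter Finset Manifold

/-! ### Representatives of `Γ₀(D) \ SL₂(ℤ)` for square-free `D` -/

theorem gamma0Cosets_mk_eq_iff {D : ℕ} {γ δ : SL(2, ℤ)} :
    (Quotient.mk _ γ : Gamma0Cosets D) = Quotient.mk _ δ ↔
      (D : ℤ) ∣ δ 1 0 * γ 1 1 - δ 1 1 * γ 1 0 := by
  have : (δ * γ⁻¹) 1 0 = δ 1 0 * γ 1 1 - δ 1 1 * γ 1 0 := by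
    rw [Matrix.SpecialLinearGroup.coe_mul, Matrix.SpecialLinearGroup.coe_inv,
      Matrix.adjugate_fin_two, Matrix.mul_apply, Fin.sum_univ_two]
    simp
    ring
  rw [Quotient.eq, QuotientGroup.rightRel_apply, CongruenceSubgroup.Gamma0_mem,
    ZMod.intCast_zmod_eq_zero_iff_dvd, this]

variable {D : ℕ}

theorem exists_inverse_mod (hD : Squarefree D) (p : Factorization D) :
    ∃ y : ℤ, (p.D₂ : ℤ) ∣ p.D₁ * y - 1 := by
  obtain ⟨u, v, h⟩ := Nat.isCoprime_iff_coprime.mpr (p.coprime hD)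
  exact ⟨u, -v, by linear_combination h⟩

/-- An inverse of `D₁` modulo `D₂`. -/
def inverseMod (hD : Squarefree D) (p : Factorization D) : ℤ := (exists_inverse_mod hD p).choose

theorem dvd_mul_inverseMod_sub_one (hD : Squarefree D) (p : Factorization D) :
    (p.D₂ : ℤ) ∣ p.D₁ * inverseMod hD p - 1 := (exists_inverse_mod hD p).choose_spec

/-- The representative attached to `D = D₁ D₂` and a residue class modulo `D₂`. -/
def cosetRep (hD : Squarefree D) (x : Σ p : Factorization D, Fin p.D₂) : SL(2, ℤ) :=
  cuspMatrix x.1.D₁ ((x.2 : ℕ) - inverseMod hD x.1)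

theorem cosetRep_eq_iff {m m' t t' : ℤ} :
    (Quotient.mk _ (cuspMatrix m t) : Gamma0Cosets D) = Quotient.mk _ (cuspMatrix m' t') ↔
      (D : ℤ) ∣ m' - m + m * m' * (t - t') := by
  rw [gamma0Cosets_mk_eq_iff]
  refine Iff.of_eq (congrArg _ ?_)
  simp [cuspMatrix]
  ring

/-- Equality of cosets forces $D_1\mid D_1'$ and conversely. With $D_1=D_1'$ it reads $D_1D_2\mid
D_1^2(y-y')$, so $y\equiv y'$ modulo $D_2$ by coprimality. -/
theorem cosetRep_injective (hD : Squarefree D) :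
    Function.Injective fun x => (Quotient.mk _ (cosetRep hD x) : Gamma0Cosets D) := by
  rintro ⟨p, y⟩ ⟨p', y'⟩ h
  have key (p p' : Factorization D) (t t' : ℤ)
      (h : (D : ℤ) ∣ (p'.D₁ : ℤ) - p.D₁ + p.D₁ * p'.D₁ * (t - t')) : p.D₁ ∣ p'.D₁ := by
    have h1 : (p.D₁ : ℤ) ∣ D := by
      exact_mod_cast Dvd.intro _ p.mul_eq
    have h2 := h1.trans h
    rw [mul_assoc, dvd_add_left (dvd_mul_right _ _), dvd_sub_left (dvd_refl _)] at h2
    exact_mod_cast h2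
  have h1 := cosetRep_eq_iff.mp h
  have h2 := cosetRep_eq_iff.mp h.symm
  have hm : p.D₁ = p'.D₁ := Nat.dvd_antisymm (key _ _ _ _ h1) (key _ _ _ _ h2)
  have hp : p = p' := by
    refine Subtype.ext (Prod.ext hm ?_)
    refine Nat.eq_of_mul_eq_mul_left (NeZero.pos p.D₁) ?_
    rw [p.mul_eq]
    exact (hm ▸ p'.mul_eq).symm
  subst hp
  congr 1
  simp only at h1
  have hm0 : (p.D₁ : ℤ) ≠ 0 := by exact_mod_cast NeZero.ne p.D₁
  have h3 : (p.D₂ : ℤ) ∣ p.D₁ * ((y : ℕ) - (y' : ℕ) : ℤ) := by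
    refine (mul_dvd_mul_iff_left hm0).mp ?_
    rw [← Nat.cast_mul, p.mul_eq]
    convert! h1 using 1
    ring
  have h4 := (Nat.isCoprime_iff_coprime.mpr (p.coprime hD).symm).dvd_of_dvd_mul_left h3
  exact Fin.ext (((Nat.modEq_iff_dvd.mpr h4).eq_of_lt_of_lt y'.2 y.2).symm)

/-- For lower row $(c,d)$ take $D_1=\gcd(c,D)$; square-freeness makes $c$ invertible modulo $D_2$,
and $y\equiv c^{-1}d$ modulo $D_2$ is the required residue. -/
theorem cosetRep_surjective [NeZero D] (hD : Squarefree D) :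
    Function.Surjective fun x => (Quotient.mk _ (cosetRep hD x) : Gamma0Cosets D) := by
  intro c
  induction c using Quotient.inductionOn with | _ γ
  have hdet := det_SL_eq_one γ
  obtain ⟨p, hp⟩ : ∃ p : Factorization D, p.D₁ = Int.gcd (γ 1 0) D := by
    have hmD : Int.gcd (γ 1 0) D ∣ D := by exact_mod_cast Int.gcd_dvd_right (γ 1 0) D
    exact ⟨⟨(_, D / _), Nat.mem_divisorsAntidiagonal.mpr
      ⟨Nat.mul_div_cancel' hmD, NeZero.ne D⟩⟩, rfl⟩
  obtain ⟨c', hc'⟩ : (p.D₁ : ℤ) ∣ γ 1 0 := hp ▸ Int.gcd_dvd_left _ _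
  have hDp : (D : ℤ) = p.D₁ * p.D₂ := by rw [← Nat.cast_mul, p.mul_eq]
  have hcop : IsCoprime (γ 1 0) (p.D₂ : ℤ) := by
    rw [Int.isCoprime_iff_gcd_eq_one]
    refine Nat.eq_one_of_dvd_coprimes (p.coprime hD) ?_ ?_
    · rw [hp]
      exact Int.dvd_gcd (Int.gcd_dvd_left _ _)
        ((Int.gcd_dvd_right _ _).trans (by exact_mod_cast Dvd.intro_left _ p.mul_eq))
    · exact_mod_cast Int.gcd_dvd_right (γ 1 0) (p.D₂ : ℤ)
  obtain ⟨u, v, huv⟩ := hcop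
  obtain ⟨w, hw⟩ := dvd_mul_inverseMod_sub_one hD p
  have hD₂ : (0 : ℤ) < p.D₂ := by exact_mod_cast NeZero.pos p.D₂
  have hy0 := Int.emod_nonneg (u * γ 1 1) hD₂.ne'
  have hy1 := Int.emod_lt_of_pos (u * γ 1 1) hD₂
  have hy2 := Int.emod_add_mul_ediv (u * γ 1 1) p.D₂
  set y := (u * γ 1 1) % p.D₂ with hy
  refine ⟨⟨p, ⟨y.toNat, by omega⟩⟩, ?_⟩
  simp only
  rw [gamma0Cosets_mk_eq_iff]
  have hyn : ((y.toNat : ℕ) : ℤ) = y := Int.toNat_of_nonneg hy0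
  have e1 : cosetRep hD ⟨p, ⟨y.toNat, by omega⟩⟩ 1 1 = 1 + p.D₁ * (y - inverseMod hD p) := by
    simp only [cosetRep, hyn]
    rfl
  have e0 : cosetRep hD ⟨p, ⟨y.toNat, by omega⟩⟩ 1 0 = p.D₁ := rfl
  rw [e1, e0, hDp]
  refine ⟨-c' * w - v * γ 1 1 - γ 1 0 * ((u * γ 1 1) / p.D₂), ?_⟩
  linear_combination -γ 1 0 * hw - p.D₂ * w * hc' + p.D₁ * γ 1 0 * hy2 + p.D₁ * γ 1 1 * huv

/-- The cosets are parametrized by the factorizations `D = D₁ D₂` and residues modulo `D₂`. -/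
def cosetEquiv [NeZero D] (hD : Squarefree D) :
    (Σ p : Factorization D, Fin p.D₂) ≃ Gamma0Cosets D :=
  Equiv.ofBijective _ ⟨cosetRep_injective hD, cosetRep_surjective hD⟩

theorem trace_eq_sum [NeZero D] (hD : Squarefree D) (m : ℤ) (g : ℍ → ℂ)
    (hg : ∀ γ ∈ CongruenceSubgroup.Gamma0 D, g ∣[m] γ = g) :
    trace D m g = ∑ p : Factorization D, ∑ y ∈ range p.D₂,
      g ∣[m] cuspMatrix p.D₁ (y - inverseMod hD p) := by
  rw [trace_eq D m g hg (fun c => cosetRep hD ((cosetEquiv hD).symm c))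
    fun c => (cosetEquiv hD).apply_symm_apply c,
    ← finsum_comp_equiv (cosetEquiv hD), finsum_eq_sum_of_fintype, Fintype.sum_sigma]
  simp only [Equiv.symm_apply_apply]
  refine sum_congr rfl fun p _ => ?_
  rw [sum_range]
  rfl

/-! ### The trace of the bracket -/

theorem star_quadChar (D : ℕ) [NeZero D] : star (quadChar D) = quadChar D := by
  ext a
  rw [MulChar.star_apply]
  change star ((jacobiSym _ D : ℤ) : ℂ) = ((jacobiSym _ D : ℤ) : ℂ)
  simp

theorem mdifferentiable_GTwo {M N : ℕ} [NeZero M] [NeZero N] {k : ℕ} (hk : 1 ≤ k)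
    (φ : DirichletCharacter ℂ M) (ψ : DirichletCharacter ℂ N) :
    MDiff (GTwo k φ ψ) :=
  (polyGrowth_sigmaTwo hk φ ψ).mdifferentiable

theorem mdifferentiable_GOne {N : ℕ} [NeZero N] {k : ℕ} (hk : 1 ≤ k)
    (φ : DirichletCharacter ℂ N) : MDiff (GOne k φ) := by
  rw [GOne_eq_GTwo]
  exact mdifferentiable_GTwo hk _ _

/-- The case $\ell=k$ is no exception, because the quadratic character is its own conjugate. -/
theorem bracket_eq [NeZero D] {χ : DirichletCharacter ℂ D} {ℓ k : ℕ} (e : ℕ) (hℓk : ℓ ≤ k)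
    (hquad : ℓ = k → χ = quadChar D) :
    bracket ℓ k e χ = rankinCohen ℓ k e (GOne ℓ χ) (GOne k χ⁻¹) := by
  rw [bracket, MulChar.star_eq_inv]
  split_ifs with h
  · rfl
  · obtain rfl : ℓ = k := by omega
    obtain rfl := hquad rfl
    rw [← MulChar.star_eq_inv, star_quadChar]

/-- The two series transform with the inverse factors $\chi(d)$ and $\bar\chi(d)$, which cancel. -/
theorem rankinCohen_GOne_slash_Gamma0 [NeZero D] {χ : DirichletCharacter ℂ D}
    (hχ : χ.IsPrimitive) {ℓ k : ℕ} (e : ℕ) (hℓ : 3 ≤ ℓ) (hk : 3 ≤ k) (h₁ : χ (-1) = (-1) ^ ℓ)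
    (h₂ : χ (-1) = (-1) ^ k) {γ : SL(2, ℤ)} (hγ : γ ∈ CongruenceSubgroup.Gamma0 D) :
    rankinCohen ℓ k e (GOne ℓ χ) (GOne k χ⁻¹) ∣[((ℓ + k + 2 * e : ℕ) : ℤ)] γ =
      rankinCohen ℓ k e (GOne ℓ χ) (GOne k χ⁻¹) := by
  rw [rankinCohen_slash (mdifferentiable_GOne (by omega : 1 ≤ ℓ) _)
    (mdifferentiable_GOne (by omega : 1 ≤ k) _) _ _ _ (by omega) (by omega),
    GOne_slash_Gamma0 hℓ hχ h₁ hγ, GOne_slash_Gamma0 hk (isPrimitive_inv hχ)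
      (by rw [inv_apply_neg_one, h₂]) hγ, rankinCohen_smul_smul]
  have h0 : ((γ 1 0 : ℤ) : ZMod D) = 0 := CongruenceSubgroup.Gamma0_mem.mp hγ
  have hu : IsUnit ((γ 1 1 : ℤ) : ZMod D) := by
    refine IsUnit.of_mul_eq_one ((γ 0 0 : ℤ) : ZMod D) ?_
    have := congrArg (Int.cast (R := ZMod D)) (det_SL_eq_one γ)
    push_cast at this
    rw [h0, mul_zero, sub_zero, mul_comm] at this
    exact this
  rw [MulChar.inv_apply_eq_inv', mul_inv_cancel₀ (hu.map χ).ne_zero, one_smul]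

/-- The scalars of the two series multiply to $(g(\chi_2)g(\bar\chi_2))^{-1}=\chi_2(-1)/D_2$, the
values at $D_1$ cancelling; $1/D_2$ is the normalization of $U_{D_2}$. -/
theorem rankinCohen_GOne_slash_cuspMatrix [NeZero D] (hD : Squarefree D)
    {χ : DirichletCharacter ℂ D} (hχ : χ.IsPrimitive) {ℓ k : ℕ} (e : ℕ) (hℓ : 3 ≤ ℓ) (hk : 3 ≤ k)
    (h₁ : χ (-1) = (-1) ^ ℓ) (h₂ : χ (-1) = (-1) ^ k) (p : Factorization D) (y : ℕ) :
    rankinCohen ℓ k e (GOne ℓ χ) (GOne k χ⁻¹) ∣[((ℓ + k + 2 * e : ℕ) : ℤ)]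
        cuspMatrix p.D₁ (y - inverseMod hD p) =
      (snd hD χ p (-1) * ((p.D₂ : ℂ) ^ e)⁻¹ * (1 / (p.D₂ : ℂ))) •
        (rankinCohen ℓ k e (GTwo ℓ (fst hD χ p) (snd hD χ p)⁻¹)
          (GTwo k (fst hD χ p)⁻¹ (snd hD χ p)) ∘ shiftDiv p.D₂ y) := by
  obtain ⟨hp₁, hp₂⟩ := isPrimitive_fst_snd hD χ hχ p
  have hf := isFactorization_fst_snd hD χ p
  have hy := dvd_mul_inverseMod_sub_one hD p
  rw [rankinCohen_slash (mdifferentiable_GOne (by omega : 1 ≤ ℓ) _)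
    (mdifferentiable_GOne (by omega : 1 ≤ k) _) _ _ _ (by omega) (by omega),
    GOne_slash_cuspMatrix p.mul_eq (p.coprime hD) hf hχ hp₁ hp₂ hℓ h₁ y hy,
    GOne_slash_cuspMatrix p.mul_eq (p.coprime hD) hf.inv (isPrimitive_inv hχ)
      (isPrimitive_inv hp₁) (isPrimitive_inv hp₂) hk (by rw [inv_apply_neg_one, h₂]) y hy,
    rankinCohen_smul_smul, rankinCohen_comp_shiftDiv, smul_smul, inv_inv]
  congr 1
  have hg := gaussSum_mul_gaussSum_inv hp₂
  have hD₂ : (p.D₂ : ℂ) ≠ 0 := NeZero.ne _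
  have hs := apply_neg_one_mul_self (snd hD χ p)
  have hs0 : snd hD χ p (-1) ≠ 0 := left_ne_zero_of_mul_eq_one hs
  have hu : IsUnit ((p.D₁ : ℕ) : ZMod p.D₂) := (ZMod.isUnit_iff_coprime _ _).mpr (p.coprime hD)
  have hu0 := (hu.map (snd hD χ p)).ne_zero
  rw [MulChar.inv_apply_eq_inv', ← mul_inv, mul_mul_mul_comm, inv_mul_cancel₀ hu0, one_mul,
    mul_comm (gaussSum _ _), hg]
  field_simp
  linear_combination -hs

theorem F_eq_sum [NeZero D] (hD : Squarefree D)
    {χ : DirichletCharacter ℂ D} (hχ : χ.IsPrimitive) {ℓ k : ℕ} (e : ℕ) (hℓ : 3 ≤ ℓ)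
    (hℓk : ℓ ≤ k) (h₁ : χ (-1) = (-1) ^ ℓ) (h₂ : χ (-1) = (-1) ^ k)
    (hquad : ℓ = k → χ = quadChar D) (z : ℍ) :
    F ℓ k e χ z = ∑ p : Factorization D,
      star (snd hD χ p) (-1) * ((p.D₂ : ℂ) ^ e)⁻¹ *
        U p.D₂ (rankinCohen ℓ k e (GTwo ℓ (fst hD χ p) (star (snd hD χ p)))
          (GTwo k (star (fst hD χ p)) (snd hD χ p))) z := by
  rw [F, bracket_eq e hℓk hquad, trace_eq_sum hD _ _ fun γ hγ =>
    rankinCohen_GOne_slash_Gamma0 hχ e hℓ (by omega) h₁ h₂ hγ, Finset.sum_apply]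
  refine sum_congr rfl fun p _ => ?_
  rw [Finset.sum_apply, U, MulChar.star_eq_inv, MulChar.star_eq_inv, inv_apply_neg_one, ← mul_assoc,
    mul_sum]
  refine sum_congr rfl fun y _ => ?_
  rw [rankinCohen_GOne_slash_cuspMatrix hD hχ e hℓ (by omega) h₁ h₂]
  rfl

/-! ### Fourier expansion of the trace -/

theorem aCoeff_zero [NeZero D] (hD : Squarefree D) (χ : DirichletCharacter ℂ D) (ℓ k : ℕ) {e : ℕ}
    (he : 1 ≤ e) : aCoeff hD ℓ k e χ 0 = 0 := by
  refine sum_eq_zero fun p _ => ?_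
  rw [zero_mul, Finset.Nat.antidiagonal_zero, sum_singleton, cCoeff_zero he, mul_zero, mul_zero]

theorem hasSum_aCoeff [NeZero D] (hD : Squarefree D) (χ : DirichletCharacter ℂ D) {ℓ k e : ℕ}
    (hℓ : 1 ≤ ℓ) (hk : 1 ≤ k) (he : 1 ≤ e) (z : ℍ) :
    HasSum (fun n : ℕ => aCoeff hD ℓ k e χ (n + 1) * q z ^ (n + 1))
      (∑ p : Factorization D, star (snd hD χ p) (-1) * ((p.D₂ : ℂ) ^ e)⁻¹ *
        U p.D₂ (rankinCohen ℓ k e (GTwo ℓ (fst hD χ p) (star (snd hD χ p)))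
          (GTwo k (star (fst hD χ p)) (snd hD χ p))) z) := by
  have h := hasSum_sum (s := univ) fun (p : Factorization D) _ =>
    (hasSum_U (hasSum_rankinCohen (polyGrowth_sigmaTwo hℓ (fst hD χ p) (star (snd hD χ p)))
      (polyGrowth_sigmaTwo hk (star (fst hD χ p)) (snd hD χ p)) ℓ k e) p.D₂ z).mul_left
      (star (snd hD χ p) (-1) * ((p.D₂ : ℂ) ^ e)⁻¹)
  have h' : HasSum (fun n : ℕ => aCoeff hD ℓ k e χ n * q z ^ n)
      (∑ p : Factorization D, star (snd hD χ p) (-1) * ((p.D₂ : ℂ) ^ e)⁻¹ *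
        U p.D₂ (rankinCohen ℓ k e (GTwo ℓ (fst hD χ p) (star (snd hD χ p)))
          (GTwo k (star (fst hD χ p)) (snd hD χ p))) z) := by
    convert! h using 1
    ext n
    rw [aCoeff, sum_mul]
    exact sum_congr rfl fun p _ => by rw [bracketCoeff]; ring
  -- Dropping the index $0$ costs nothing, as that coefficient vanishes for $e\ge1$.
  rw [← hasSum_nat_add_iff' 1] at h'
  simpa [aCoeff_zero hD χ ℓ k he] using h'

end TraceEis

end

theorem mainTheorem5 (D : ℕ) [NeZero D] (hodd : Odd D) (hD : Squarefree D)
    (χ : DirichletCharacter ℂ D) (hprim : χ.IsPrimitive)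
    (ℓ k e : ℕ) (he : 1 ≤ e) (hℓ : 3 ≤ ℓ) (hℓk : ℓ ≤ k) (hpar : ℓ ≡ k [MOD 2])
    (hχ : χ (-1) = (-1) ^ ℓ) (hquad : ℓ = k → χ = TraceEis.quadChar D) :
    -- the bracket is invariant under `Γ₀(D)`, so that its trace is well defined
    (∀ γ ∈ CongruenceSubgroup.Gamma0 D,
      TraceEis.bracket ℓ k e χ ∣[((ℓ + k + 2 * e : ℕ) : ℤ)] γ = TraceEis.bracket ℓ k e χ) ∧
    (∀ z : ℍ, TraceEis.F ℓ k e χ z =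
      ∑ p : TraceEis.Factorization D,
        star (TraceEis.snd hD χ p) (-1) * ((p.D₂ : ℂ) ^ e)⁻¹ *
          TraceEis.U p.D₂
            (TraceEis.rankinCohen ℓ k e
              (TraceEis.GTwo ℓ (TraceEis.fst hD χ p) (star (TraceEis.snd hD χ p)))
              (TraceEis.GTwo k (star (TraceEis.fst hD χ p)) (TraceEis.snd hD χ p))) z) ∧
    -- the Fourier expansion `∑_{n ≥ 1} a_{D,ℓ,k,e}(n;χ) q^n`
    (∀ z : ℍ, HasSum (fun n : ℕ => TraceEis.aCoeff hD ℓ k e χ (n + 1) * TraceEis.q z ^ (n + 1))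
      (TraceEis.F ℓ k e χ z)) := by
  have hχ' : χ (-1) = (-1) ^ k := by
    rw [hχ, neg_one_pow_eq_pow_mod_two, hpar, ← neg_one_pow_eq_pow_mod_two]
  have hF := TraceEis.F_eq_sum hD hprim e hℓ hℓk hχ hχ' hquad
  refine ⟨fun γ hγ => ?_, hF, fun z => ?_⟩
  · rw [TraceEis.bracket_eq e hℓk hquad]
    exact TraceEis.rankinCohen_GOne_slash_Gamma0 hprim e hℓ (by omega) hχ hχ' hγ
  · rw [hF z]
    exact TraceEis.hasSum_aCoeff hD χ (by omega) (by omega) he z
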